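/- (Higher-order Minkowski formula.) Let $n\ge 2$ and $\theta\in(0,\pi)$, let $\mathbb{B}^m$ denote the open unit ball of $\mathbb{R}^m$ centred at the origin, and let $\mathbb{S}^n=\partial\mathbb{B}^{n+1}$. Let $\Sigma\subset\overline{\mathbb{B}}^{n+1}$ be a smooth properly embedded hypersurface given by an embedding $x:\overline{\mathbb{B}}^{n}\to\overline{\mathbb{B}}^{n+1}$, smooth up to the boundary, with $x(\mathbb{B}^n)\subset\mathbb{B}^{n+1}$ and $x(\partial\mathbb{B}^n)\subset\mathbb{S}^n$. Let $\nu$ be a smooth unit normal field of $\Sigma$ along $x$, and suppose that $\Sigma$ has $\theta$-capillary boundary, i.e. $\langle \nu,\bar N\circ x\rangle=-\cos\theta$ along $\partial\mathbb{B}^n$, where $\bar N$ is the outward unit normal of $\mathbb{S}^n$. Let $dA$ be the area element of the induced metric. Let $h(X,Y)=-\langle D_XY,\nu\rangle$ be the second fundamental form ($D$ the Euclidean connection), let the principal curvatures $\kappa_1,\dots,\kappa_n$ be the eigenvalues of $h$ with respect to the induced metric, and for $0\le k\le n$ let $H_k=\binom{n}{k}^{-1}\sigma_k(\kappa_1,\dots,\kappa_n)$,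 where $\sigma_k$ is the $k$-th elementary symmetric polynomial, with $H_0=\sigma_0=1$. For a unit vector $e\in\mathbb{R}^{n+1}$ let $$X_e(y)=\langle y,e\rangle y-\tfrac12(|y|^2+1)e,\qquad y\in\mathbb{R}^{n+1}.$$ Then for every unit vector $e\in\mathbb{R}^{n+1}$ and every integer $1\le k\le n$, $$\int_\Sigma H_{k-1}\bigl(\langle x,e\rangle+\cos\theta\,\langle\nu,e\rangle\bigr)\,dA=\int_\Sigma H_k\,\langle X_e,\nu\rangle\,dA .$$ Moreover, $X_e$ is a conformal Killing field of $\mathbb{R}^{n+1}$, namely $\langle D_vX_e,w\rangle+\langle v,D_wX_e\rangle=2\langle y,e\rangle\langle v,w\rangle$ at every $y\in\mathbb{R}^{n+1}$ for all $v,w\in\mathbb{R}^{n+1}$, and it is tangent to the unit sphere: $\langle X_e(y),y\rangle=0$ whenever $|y|=1$. -/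

import Mathlib

open scoped ContDiff

noncomputable section

namespace Capillary

/-- The Euclidean space `ℝᵐ`. -/
abbrev E (m : ℕ) : Type := EuclideanSpace ℝ (Fin m)

/-- The closed unit ball of `ℝⁿ`, the parameter domain of the hypersurface. -/
abbrev cball (n : ℕ) : Set (E n) := Metric.closedBall 0 1

variable {n : ℕ}

/-- The partial derivative `∂ᵢ f` on the closed unit ball (one-sided at boundary points). -/
def pd {F : Type*} [NormedAddCommGroup F] [NormedSpace ℝ F]
    (i : Fin n) (f : E n → F) (p : E n) : F :=
  fderivWithin ℝ f (cball n) p (EuclideanSpace.single i 1)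

/-- `x` restricts to a smooth (up to the boundary) embedding of the closed unit ball of `ℝⁿ`
into the closed unit ball of `ℝⁿ⁺¹` that is proper: open ball into open ball, boundary sphere into
boundary sphere.  As the closed ball is compact, an injective immersion of it is an embedding. -/
structure IsProperEmbedding (x : E n → E (n + 1)) : Prop where
  smooth : ContDiffOn ℝ ∞ x (cball n)
  injOn : Set.InjOn x (cball n)
  immersion : ∀ p ∈ cball n, Function.Injective (fderivWithin ℝ x (cball n) p)
  mapsTo_ball : Set.MapsTo x (Metric.ball 0 1) (Metric.ball 0 1)
  mapsTo_sphere : Set.MapsTo x (Metric.sphere 0 1) (Metric.sphere 0 1)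

/-- `ν` is a smooth unit normal field along `x`. -/
structure IsUnitNormal (x ν : E n → E (n + 1)) : Prop where
  smooth : ContDiffOn ℝ ∞ ν (cball n)
  norm_eq_one : ∀ p ∈ cball n, ‖ν p‖ = 1
  normal : ∀ p ∈ cball n, ∀ v : E n, inner ℝ (fderivWithin ℝ x (cball n) p v) (ν p) = 0

/-- `⟨ν, N̄ ∘ x⟩ = -cos θ` along the boundary, where the outward unit normal `N̄` of the unit sphere
at a point `y` of the sphere is `y` itself. -/
def HasCapillaryBoundary (θ : ℝ) (x ν : E n → E (n + 1)) : Prop :=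
  ∀ p ∈ Metric.sphere (0 : E n) 1, inner ℝ (ν p) (x p) = -Real.cos θ

/-- The induced metric `g i j = ⟨∂ᵢ x, ∂ⱼ x⟩`. -/
def metric (x : E n → E (n + 1)) (p : E n) : Matrix (Fin n) (Fin n) ℝ :=
  Matrix.of fun i j => inner ℝ (pd i x p) (pd j x p)

/-- The second fundamental form `h(X, Y) = -⟨D_X Y, ν⟩`, that is `h i j = -⟨∂ᵢ ∂ⱼ x, ν⟩`. -/
def secondFundamentalForm (x ν : E n → E (n + 1)) (p : E n) : Matrix (Fin n) (Fin n) ℝ :=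
  Matrix.of fun i j => -inner ℝ (pd i (pd j x) p) (ν p)

/-- The matrix `hⁱⱼ = gⁱᵏ hₖⱼ` of the Weingarten operator. -/
def weingarten (x ν : E n → E (n + 1)) (p : E n) : Matrix (Fin n) (Fin n) ℝ :=
  (metric x p)⁻¹ * secondFundamentalForm x ν p

/-- The principal curvatures: the eigenvalues of the Weingarten operator with multiplicity. -/
def principalCurvatures (x ν : E n → E (n + 1)) (p : E n) : Multiset ℝ :=
  (weingarten x ν p).charpoly.roots

/-- The normalized `k`-th mean curvature: `σₖ` of the principal curvatures over `n.choose k`. -/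
def H (x ν : E n → E (n + 1)) (k : ℕ) (p : E n) : ℝ :=
  (principalCurvatures x ν p).esymm k / (n.choose k : ℝ)

/-- `∫_Σ f dA` for the hypersurface `Σ` parametrized by `x`, with `dA = √(det g) dp`; the integrand
is given as a function of the parameter. -/
def surfaceIntegral (x : E n → E (n + 1)) (f : E n → ℝ) : ℝ :=
  ∫ p in cball n, f p * Real.sqrt (metric x p).det

/-- The vector field `X_e = ⟨y, e⟩ y - ½ (|y|² + 1) e`. -/
def confField {m : ℕ} (e y : E m) : E m :=
  inner ℝ y e • y - ((‖y‖ ^ 2 + 1) / 2) • e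

end Capillary

end

open scoped ContDiff

noncomputable section

namespace Capillary

variable {n : ℕ}

/-! ### Divergence theorem on the closed unit ball. -/

section

open MeasureTheory Topology Filter

/-! All orders k are treated at once with a generating parameter t. Put V = X_e - ⟨X_e, ν⟩ν + cos θ
(⟨ν, e⟩x - ⟨x, ν⟩e), a field tangent to Σ, and let Yⱼ = ∂ⱼ(x + tν) be the frame of the parallel
hypersurface. The determinants of (ν, Y₁, …, Yₙ) with V replacing Yᵢ are the components of a vector
field on the parameter ball; its divergence generates the divergences of the Newton tensors applied
to V.

Since ∂ᵢYⱼ = ∂ⱼYᵢ, the divergence involves only the derivatives of V (`sum_pd_flux`). Modulo ν, ∂ᵢV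
consists of q ∂ᵢx - r ∂ᵢν, with q = ⟨x, e⟩ + cos θ ⟨ν, e⟩ and r = ⟨X_e, ν⟩, and of terms skew in x
and e, which cancel because the Weingarten operator A is self-adjoint (`sum_vol_update_eq`). There
remains ±√(det g) (q tr adj(1 + tA) - r tr(adj(1 + tA)A)), whose coefficient of tᵏ is ±√(det g) ((n
- k)σₖ q - (k + 1)σₖ₊₁ r) (`trace_adjugate_combination`).

There is no boundary flux (`sum_mul_parallelFlux_eq_zero`): the factor cos θ makes V tangent to the
unit sphere, and the constant contact angle makes the conormal of ∂Σ a principal direction. So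
`integral_divergence_eq_zero` applies for every t, and comparing coefficients of tᵏ gives the
formula. The two statements about X_e are direct computations from its derivative. -/

lemma uniqueDiffOn_cball : UniqueDiffOn ℝ (cball n) :=
  uniqueDiffOn_convex (convex_closedBall 0 1) (by simp [interior_closedBall])

lemma isCompact_cball : IsCompact (cball n) := isCompact_closedBall 0 1

/-- The cutoff function `1` on most of the ball that vanishes near its boundary. -/
def cutoff (N : ℕ) (p : E n) : ℝ := Real.smoothTransition (N * (1 - ‖p‖ ^ 2) - 1)

lemma hasFDerivAt_cutoff (N : ℕ) (p : E n) :
    HasFDerivAt (cutoff N)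
      ((deriv Real.smoothTransition (N * (1 - ‖p‖ ^ 2) - 1) * (-2 * N)) • innerSL ℝ p) p := by
  have h1 : HasFDerivAt (fun p : E n => (N : ℝ) * (1 - ‖p‖ ^ 2) - 1)
      ((-2 * N : ℝ) • innerSL ℝ p) p := by
    have := (((hasStrictFDerivAt_norm_sq p).hasFDerivAt.const_sub 1).const_mul (N : ℝ)).sub_const 1
    refine this.congr_fderiv ?_
    ext v; simp; ring
  have h2 : DifferentiableAt ℝ Real.smoothTransition (N * (1 - ‖p‖ ^ 2) - 1) :=
    (Real.smoothTransition.contDiffAt (n := 1)).differentiableAt (by simp)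
  have := h2.hasDerivAt.comp_hasFDerivAt p h1
  rw [smul_smul] at this
  exact this

lemma continuous_cutoff (N : ℕ) : Continuous (cutoff N : E n → ℝ) :=
  continuous_iff_continuousAt.2 fun p => (hasFDerivAt_cutoff N p).continuousAt

lemma continuous_deriv_smoothTransition : Continuous (deriv Real.smoothTransition) :=
  (Real.smoothTransition.contDiff (n := 1)).continuous_deriv (by simp)

lemma continuous_fderiv_cutoff (N : ℕ) (v : E n) :
    Continuous fun p => fderiv ℝ (cutoff N) p v := by
  have : (fun p : E n => fderiv ℝ (cutoff N) p v) = fun p =>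
      (deriv Real.smoothTransition (N * (1 - ‖p‖ ^ 2) - 1) * (-2 * N)) * inner ℝ p v := by
    ext p; rw [(hasFDerivAt_cutoff N p).fderiv]; simp
  rw [this]
  have := continuous_deriv_smoothTransition
  fun_prop

/-- The shift by 1 in the cutoff keeps its support in N(1 - |p|²) ≥ 1, a closed set that stays away
from the sphere and is empty for N = 0. -/
lemma tsupport_cutoff_subset (N : ℕ) : tsupport (cutoff N : E n → ℝ) ⊆ Metric.ball 0 1 := by
  have h : tsupport (cutoff N : E n → ℝ) ⊆ {p | 1 ≤ (N : ℝ) * (1 - ‖p‖ ^ 2)} := by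
    refine closure_minimal ?_ (isClosed_le (by fun_prop) (by fun_prop))
    intro p hp
    by_contra h
    exact hp (Real.smoothTransition.zero_of_nonpos (by simp at h; linarith))
  intro p hp
  have h1 := h hp
  simp only [Set.mem_ofPred_eq] at h1
  rw [mem_ball_zero_iff]
  by_contra h2
  push Not at h2
  nlinarith [Nat.cast_nonneg (α := ℝ) N, mul_nonneg (Nat.cast_nonneg (α := ℝ) N) (by nlinarith : 0 ≤ ‖p‖ ^ 2 - 1)]

lemma cutoff_eq_zero {N : ℕ} {p : E n} (hp : p ∉ Metric.ball (0 : E n) 1) : cutoff N p = 0 :=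
  image_eq_zero_of_notMem_tsupport fun h => hp (tsupport_cutoff_subset N h)

lemma pd_eq_fderiv {F : Type*} [NormedAddCommGroup F] [NormedSpace ℝ F] (i : Fin n) (f : E n → F)
    {p : E n} (hp : p ∈ Metric.ball (0 : E n) 1) :
    pd i f p = fderiv ℝ f p (EuclideanSpace.single i 1) := by
  unfold pd
  rw [fderivWithin_of_mem_nhds (Filter.mem_of_superset (Metric.isOpen_ball.mem_nhds hp)
    Metric.ball_subset_closedBall)]

lemma contDiffOn_pd {F : Type*} [NormedAddCommGroup F] [NormedSpace ℝ F] {f : E n → F}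
    {m k : WithTop ℕ∞} (hf : ContDiffOn ℝ k f (cball n)) (hk : m + 1 ≤ k) (i : Fin n) :
    ContDiffOn ℝ m (pd i f) (cball n) :=
  (hf.fderivWithin uniqueDiffOn_cball hk).clm_apply contDiffOn_const

lemma continuousOn_pd {F : Type*} [NormedAddCommGroup F] [NormedSpace ℝ F] {f : E n → F}
    (hf : ContDiffOn ℝ 1 f (cball n)) (i : Fin n) : ContinuousOn (pd i f) (cball n) :=
  (contDiffOn_pd (m := 0) hf (by simp) i).continuousOn

/-- The cutoff is supported in the open ball, so both integrals extend to the whole space, one-sided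
derivatives become ordinary ones, and integration by parts has no boundary term. -/
lemma integral_cutoff_mul_pd (N : ℕ) (i : Fin n) {w : E n → ℝ}
    (hw : ContDiffOn ℝ 1 w (cball n)) :
    ∫ p in cball n, cutoff N p * pd i w p =
      -∫ p in cball n, fderiv ℝ (cutoff N) p (EuclideanSpace.single i 1) * w p := by
  have hsub : Metric.ball (0 : E n) 1 ⊆ cball n := Metric.ball_subset_closedBall
  have hts := tsupport_cutoff_subset (n := n) N
  have key : ∀ (φ h : E n → ℝ), Continuous φ → tsupport φ ⊆ Metric.ball 0 1 →
      ContinuousOn h (cball n) → Integrable (fun p => φ p * h p) ∧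
      ∫ p in cball n, φ p * h p = ∫ p, φ p * h p := by
    intro φ h hφ hs hh
    have e : (cball n).indicator (fun p => φ p * h p) = fun p => φ p * h p := by
      refine Set.indicator_eq_self.2 fun p hp => hsub (hs (subset_tsupport _ ?_))
      intro h0
      simp [h0] at hp
    have m : MeasurableSet (cball n) := measurableSet_closedBall
    refine ⟨?_, ?_⟩
    · rw [← e, integrable_indicator_iff m]
      exact (hφ.continuousOn.mul hh).integrableOn_compact isCompact_cball
    · rw [← integral_indicator m, e]
  have e1 : (fun p => cutoff N p * pd i w p) =
      fun p => cutoff N p * fderiv ℝ w p (EuclideanSpace.single i 1) := by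
    ext p
    by_cases hp : p ∈ Metric.ball (0 : E n) 1
    · rw [pd_eq_fderiv i w hp]
    · rw [cutoff_eq_zero hp]; simp
  have k1 := key _ _ (continuous_cutoff N) hts (continuousOn_pd hw i)
  have hts' : tsupport (fun p : E n => fderiv ℝ (cutoff N) p (EuclideanSpace.single i 1)) ⊆
      Metric.ball 0 1 :=
    (tsupport_fderiv_apply_subset ℝ _).trans hts
  have k2 := key _ _ (continuous_fderiv_cutoff N (EuclideanSpace.single i 1)) hts' hw.continuousOn
  have k3 := key _ _ (continuous_cutoff N) hts hw.continuousOn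
  rw [k1.2, k2.2, e1]
  refine integral_mul_fderiv_eq_neg_fderiv_mul_of_integrable k2.1 (e1 ▸ k1.1) k3.1
    (fun p _ => (hasFDerivAt_cutoff N p).differentiableAt) (fun p hp => ?_)
  exact ((hw.differentiableOn (by simp)) p (hsub (hts hp))).differentiableAt
    (Filter.mem_of_superset (Metric.isOpen_ball.mem_nhds (hts hp)) hsub)

/-- A `C¹` function on the closed ball that vanishes on the sphere is dominated by the distance
to the sphere. -/
lemma exists_abs_le_of_eq_zero_on_sphere (hn : 0 < n) {f : E n → ℝ}
    (hf : ContDiffOn ℝ 1 f (cball n)) (h0 : ∀ p ∈ Metric.sphere (0 : E n) 1, f p = 0) :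
    ∃ L : ℝ, 0 ≤ L ∧ ∀ p ∈ cball n, |f p| ≤ L * (1 - ‖p‖ ^ 2) := by
  obtain ⟨L, hL⟩ := isCompact_cball.exists_bound_of_continuousOn
    (hf.continuousOn_fderivWithin uniqueDiffOn_cball le_rfl)
  have hL0 : 0 ≤ L := (norm_nonneg _).trans (hL 0 (by simp))
  refine ⟨L, hL0, fun p hp => ?_⟩
  have hp1 : ‖p‖ ≤ 1 := by simpa using hp
  -- Compare p with its radial projection u, where f vanishes; at p = 0 any unit vector serves,
  -- which needs n > 0.
  obtain ⟨u, hu, hpu⟩ : ∃ u : E n, ‖u‖ = 1 ∧ p = ‖p‖ • u := by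
    by_cases hp0 : p = 0
    · exact ⟨EuclideanSpace.single ⟨0, hn⟩ 1, by simp, by simp [hp0]⟩
    · refine ⟨‖p‖⁻¹ • p, by simp [norm_smul, hp0], by simp [smul_smul, hp0]⟩
  have h1 := (convex_closedBall (0 : E n) 1).norm_image_sub_le_of_norm_fderivWithin_le
    (hf.differentiableOn (by simp)) hL (x := u) (by simp [hu]) hp
  rw [h0 u (by simp [hu]), sub_zero, Real.norm_eq_abs] at h1
  have h2 : ‖p - u‖ = 1 - ‖p‖ := by
    have : p - u = (‖p‖ - 1) • u := by rw [sub_smul, one_smul, ← hpu]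
    rw [this, norm_smul, hu, mul_one, Real.norm_eq_abs, abs_of_nonpos (by linarith)]; ring
  rw [h2] at h1
  refine h1.trans (mul_le_mul_of_nonneg_left ?_ hL0)
  nlinarith [norm_nonneg p]

/-- The divergence theorem on the closed unit ball for fields tangent to the sphere. -/
theorem integral_divergence_eq_zero (hn : 0 < n) {w : Fin n → E n → ℝ}
    (hw : ∀ i, ContDiffOn ℝ 1 (w i) (cball n))
    (h0 : ∀ p ∈ Metric.sphere (0 : E n) 1, ∑ i, p i * w i p = 0) :
    ∫ p in cball n, ∑ i, pd i (w i) p = 0 := by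
  have hmeas : MeasurableSet (cball n) := measurableSet_closedBall
  have hdiv : ContinuousOn (fun p => ∑ i, pd i (w i) p) (cball n) :=
    continuousOn_finsetSum _ fun i _ => continuousOn_pd (hw i) i
  set f : E n → ℝ := fun p => ∑ i, p i * w i p with hf_def
  have hf : ContDiffOn ℝ 1 f (cball n) := by
    refine ContDiffOn.sum fun i _ => ContDiffOn.mul ?_ (hw i)
    exact (EuclideanSpace.proj (𝕜 := ℝ) i).contDiff.contDiffOn
  obtain ⟨L, hL0, hL⟩ := exists_abs_le_of_eq_zero_on_sphere hn hf h0
  -- On the ball the argument N(1 - |p|²) - 1 is at least -1, and beyond 1 the derivative is zero,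
  -- so a bound on [-1, 1] suffices.
  obtain ⟨K, hK⟩ := (isCompact_Icc (a := (-1 : ℝ)) (b := 1)).exists_bound_of_continuousOn
    continuous_deriv_smoothTransition.continuousOn
  have hK0 : 0 ≤ K := (norm_nonneg _).trans (hK 0 (by simp))
  have hder : ∀ s : ℝ, 1 < s → deriv Real.smoothTransition s = 0 := by
    intro s hs
    have : Real.smoothTransition =ᶠ[𝓝 s] fun _ => 1 := by
      filter_upwards [eventually_gt_nhds hs] with t ht using
        Real.smoothTransition.one_of_one_le ht.le
    rw [this.deriv_eq]; simp
  -- The gradient of the cutoff is radial, so only the radial component f of the field survives.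
  have hparts : ∀ N : ℕ, ∫ p in cball n, cutoff N p * ∑ i, pd i (w i) p =
      ∫ p in cball n, 2 * N * deriv Real.smoothTransition (N * (1 - ‖p‖ ^ 2) - 1) * f p := by
    intro N
    have h1 : ∫ p in cball n, cutoff N p * ∑ i, pd i (w i) p =
        ∑ i, ∫ p in cball n, cutoff N p * pd i (w i) p := by
      simp_rw [Finset.mul_sum]
      exact integral_finsetSum _ fun i _ => ((continuous_cutoff N).continuousOn.mul
        (continuousOn_pd (hw i) i)).integrableOn_compact isCompact_cball
    rw [h1]
    simp_rw [integral_cutoff_mul_pd N _ (hw _)]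
    rw [Finset.sum_neg_distrib, ← integral_finsetSum]
    · rw [← integral_neg]
      congr 1
      ext p
      simp_rw [(hasFDerivAt_cutoff N p).fderiv, hf_def, Finset.mul_sum]
      rw [← Finset.sum_neg_distrib]
      refine Finset.sum_congr rfl fun i _ => ?_
      simp [EuclideanSpace.inner_single_right]
      ring
    · exact fun i _ => ((continuous_fderiv_cutoff N _).continuousOn.mul
        (hw i).continuousOn).integrableOn_compact isCompact_cball
  have hball : ∀ᵐ p ∂(volume.restrict (cball n)), p ∈ Metric.ball (0 : E n) 1 := by
    have : ∀ᵐ p : E n, p ∉ Metric.sphere (0 : E n) 1 := by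
      exact measure_eq_zero_iff_ae_notMem.1 (Measure.addHaar_sphere_of_ne_zero volume (0 : E n) one_ne_zero)
    filter_upwards [ae_restrict_mem hmeas, ae_restrict_of_ae this] with p h1 h2
    simp only [mem_sphere_zero_iff_norm, mem_closedBall_zero_iff, mem_ball_zero_iff] at *
    exact lt_of_le_of_ne h1 h2
  have hlarge : ∀ p ∈ Metric.ball (0 : E n) 1,
      ∀ᶠ N : ℕ in atTop, 1 < (N : ℝ) * (1 - ‖p‖ ^ 2) - 1 := by
    intro p hp
    rw [mem_ball_zero_iff] at hp
    have : 0 < 1 - ‖p‖ ^ 2 := by nlinarith [norm_nonneg p]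
    have ht : Tendsto (fun N : ℕ => (N : ℝ) * (1 - ‖p‖ ^ 2)) atTop atTop :=
      tendsto_natCast_atTop_atTop.atTop_mul_const this
    filter_upwards [ht.eventually_gt_atTop 2] with N hN
    linarith
  have t1 : Tendsto (fun N : ℕ => ∫ p in cball n, cutoff N p * ∑ i, pd i (w i) p) atTop
      (𝓝 (∫ p in cball n, ∑ i, pd i (w i) p)) := by
    refine tendsto_integral_of_dominated_convergence (fun p => ‖∑ i, pd i (w i) p‖) ?_ ?_ ?_ ?_
    · exact fun N => ((continuous_cutoff N).continuousOn.mul hdiv).aestronglyMeasurable hmeas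
    · exact (hdiv.norm).integrableOn_compact isCompact_cball
    · refine fun N => Eventually.of_forall fun p => ?_
      rw [norm_mul]
      refine mul_le_of_le_one_left (norm_nonneg _) ?_
      rw [Real.norm_eq_abs, cutoff, abs_of_nonneg (Real.smoothTransition.nonneg _)]
      exact Real.smoothTransition.le_one _
    · filter_upwards [hball] with p hp
      refine tendsto_const_nhds.congr' ?_
      filter_upwards [hlarge p hp] with N hN
      rw [cutoff, Real.smoothTransition.one_of_one_le hN.le, one_mul]
  have t2 : Tendsto (fun N : ℕ => ∫ p in cball n,
      2 * N * deriv Real.smoothTransition (N * (1 - ‖p‖ ^ 2) - 1) * f p) atTop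
      (𝓝 (∫ _ in cball n, (0 : ℝ))) := by
    -- Where the derivative is nonzero, N(1 - |p|²) ≤ 2; the factor N is absorbed by |f| ≤ L(1 -
    -- |p|²), giving 2 · K · L · 2.
    refine tendsto_integral_of_dominated_convergence (fun p => 4 * K * L) ?_ ?_ ?_ ?_
    · intro N
      have := continuous_deriv_smoothTransition
      refine ContinuousOn.aestronglyMeasurable ?_ hmeas
      exact (Continuous.continuousOn (by fun_prop)).mul hf.continuousOn
    · exact continuousOn_const.integrableOn_compact isCompact_cball
    · intro N
      filter_upwards [ae_restrict_mem hmeas] with p hp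
      have hp1 : ‖p‖ ≤ 1 := by simpa using hp
      have hq : 0 ≤ 1 - ‖p‖ ^ 2 := by nlinarith [norm_nonneg p]
      have hN : (0 : ℝ) ≤ N := Nat.cast_nonneg N
      by_cases hs : 1 < (N : ℝ) * (1 - ‖p‖ ^ 2) - 1
      · rw [hder _ hs]; simp; positivity
      · push Not at hs
        have hb := hK (N * (1 - ‖p‖ ^ 2) - 1) ⟨by nlinarith, hs⟩
        rw [norm_mul, norm_mul, Real.norm_eq_abs (f p)]
        have e1 : ‖(2 * N : ℝ)‖ = 2 * N := by rw [Real.norm_eq_abs, abs_of_nonneg (by positivity)]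
        rw [e1]
        calc 2 * (N : ℝ) * ‖deriv Real.smoothTransition (N * (1 - ‖p‖ ^ 2) - 1)‖ * |f p|
            ≤ 2 * (N : ℝ) * K * (L * (1 - ‖p‖ ^ 2)) := by
              gcongr
              exact hL p hp
          _ = 2 * K * L * (N * (1 - ‖p‖ ^ 2)) := by ring
          _ ≤ 2 * K * L * 2 := by gcongr; linarith
          _ = 4 * K * L := by ring
    · filter_upwards [hball] with p hp
      refine tendsto_const_nhds.congr' ?_
      filter_upwards [hlarge p hp] with N hN
      rw [hder _ hN]; simp
  simp_rw [hparts] at t1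
  rw [tendsto_nhds_unique t1 t2]
  simp

end

/-! ### Determinant fluxes and their divergence. -/

section

/-- The determinant of `n + 1` vectors of `ℝⁿ⁺¹`. -/
def vol (m : ℕ) : E m [⋀^Fin m]→ₗ[ℝ] ℝ :=
  (Matrix.detRowAlternating (n := Fin m) (R := ℝ)).compLinearMap
    (WithLp.linearEquiv 2 ℝ (Fin m → ℝ)).toLinearMap

lemma vol_apply {m : ℕ} (v : Fin m → E m) : vol m v = (Matrix.of fun i j => v i j).det := rfl

/-- The determinant as a continuous multilinear map. -/
def volCont (m : ℕ) : ContinuousMultilinearMap ℝ (fun _ : Fin m => E m) ℝ where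
  toMultilinearMap := (vol m).toMultilinearMap
  cont := by
    change Continuous fun v : Fin m → E m => (Matrix.of fun i j => v i j).det
    refine Continuous.matrix_det (continuous_matrix fun i j => ?_)
    simp only [Matrix.of_apply]
    fun_prop

lemma volCont_apply {m : ℕ} (v : Fin m → E m) : volCont m v = vol m v := rfl

lemma pd_vol {m : ℕ} {Z : Fin m → E n → E m} {p : E n} (hp : p ∈ cball n)
    (hZ : ∀ a, DifferentiableWithinAt ℝ (Z a) (cball n) p) (i : Fin n) :
    pd i (fun q => vol m fun a => Z a q) p =
      ∑ a, vol m (Function.update (fun a => Z a p) a (pd i (Z a) p)) := by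
  have h := HasFDerivWithinAt.multilinear_comp (volCont m) fun a => (hZ a).hasFDerivWithinAt
  simp only [volCont_apply] at h
  unfold pd
  rw [h.fderivWithin (uniqueDiffOn_cball p hp)]
  simp [volCont_apply]

lemma contDiffOn_vol {m : ℕ} {Z : Fin m → E n → E m} {k : WithTop ℕ∞}
    (hZ : ∀ a, ContDiffOn ℝ k (Z a) (cball n)) :
    ContDiffOn ℝ k (fun q => vol m fun a => Z a q) (cball n) :=
  (volCont m).contDiff.comp_contDiffOn (contDiffOn_pi.2 hZ)

/-- The vectors lie in the hyperplane orthogonal to u, so the matrix with these rows kills u. -/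
lemma vol_eq_zero_of_inner_eq_zero {m : ℕ} {v : Fin m → E m} {u : E m} (hu : u ≠ 0)
    (h : ∀ a, inner ℝ (v a) u = 0) : vol m v = 0 := by
  rw [vol_apply, ← Matrix.exists_mulVec_eq_zero_iff]
  refine ⟨fun j => u j, fun h0 => hu (by ext j; exact congrFun h0 j), ?_⟩
  ext a
  have := h a
  rw [PiLp.inner_apply] at this
  simpa [Matrix.mulVec, dotProduct, mul_comm] using this

/-- The fluxes `det (ν, Y₁, …, V, …, Yₙ)`, with `V` in place of `Yᵢ`. -/
def flux (ν V : E n → E (n + 1)) (Y : Fin n → E n → E (n + 1)) (i : Fin n) (p : E n) : ℝ :=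
  vol (n + 1) (Fin.cons (ν p) (Function.update (fun j => Y j p) i (V p)))

lemma flux_eq (ν V : E n → E (n + 1)) (Y : Fin n → E n → E (n + 1)) (i : Fin n) :
    flux ν V Y i = fun p => vol (n + 1) fun a =>
      (Fin.cons ν (Function.update Y i V) : Fin (n + 1) → E n → E (n + 1)) a p := by
  ext p
  unfold flux
  congr 1
  ext1 a
  refine Fin.cases rfl (fun j => ?_) a
  by_cases h : j = i
  · subst h; simp
  · simp [h]

lemma contDiffOn_flux {ν V : E n → E (n + 1)} {Y : Fin n → E n → E (n + 1)} {k : WithTop ℕ∞}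
    (hν : ContDiffOn ℝ k ν (cball n)) (hV : ContDiffOn ℝ k V (cball n))
    (hY : ∀ j, ContDiffOn ℝ k (Y j) (cball n)) (i : Fin n) :
    ContDiffOn ℝ k (flux ν V Y i) (cball n) := by
  rw [flux_eq]
  refine contDiffOn_vol fun a => Fin.cases hν (fun j => ?_) a
  by_cases h : j = i
  · subst h; simpa using hV
  · simpa [h] using hY j

/-- The divergence of the fluxes of a tangential field. -/
lemma sum_pd_flux {ν V : E n → E (n + 1)} {Y : Fin n → E n → E (n + 1)} {p : E n}
    (hp : p ∈ cball n)
    (dν : DifferentiableWithinAt ℝ ν (cball n) p) (dV : DifferentiableWithinAt ℝ V (cball n) p)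
    (dY : ∀ j, DifferentiableWithinAt ℝ (Y j) (cball n) p)
    (hsymm : ∀ i j, pd i (Y j) p = pd j (Y i) p)
    (h0 : ν p ≠ 0) (hY : ∀ j, inner ℝ (Y j p) (ν p) = 0) (hV : inner ℝ (V p) (ν p) = 0)
    (hN : ∀ i, inner ℝ (pd i ν p) (ν p) = 0) :
    ∑ i, pd i (flux ν V Y i) p =
      ∑ i, vol (n + 1) (Fin.cons (ν p) (Function.update (fun j => Y j p) i (pd i V p))) := by
  set y : Fin n → E (n + 1) := fun j => Y j p with hy
  -- `F i j` is the term of ∂ᵢ of the i-th flux in which the derivative falls on Yⱼ; for j = i that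
  -- slot holds V, whence the value 0.
  set F : Fin n → Fin n → ℝ := fun i j => if i = j then 0 else
    vol (n + 1) (Fin.cons (ν p) (Function.update (Function.update y i (V p)) j (pd i (Y j) p)))
    with hF
  have key : ∀ i, pd i (flux ν V Y i) p =
      vol (n + 1) (Fin.cons (ν p) (Function.update y i (pd i V p))) + ∑ j, F i j := by
    intro i
    rw [flux_eq, pd_vol hp]
    · have e : (fun a => (Fin.cons ν (Function.update Y i V) : Fin (n + 1) → E n → E (n + 1)) a p)
          = Fin.cons (ν p) (Function.update y i (V p)) := by
        ext1 a
        refine Fin.cases rfl (fun j => ?_) a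
        by_cases h : j = i
        · subst h; simp
        · simp [h, hy]
      rw [e, Fin.sum_univ_succ, Fin.update_cons_zero]
      simp only [Fin.cons_zero, Fin.cons_succ]
      -- The term with ∂ᵢν in the first slot vanishes: all its entries are orthogonal to ν.
      rw [vol_eq_zero_of_inner_eq_zero h0, zero_add,
        ← Finset.add_sum_erase _ _ (Finset.mem_univ i),
        ← Finset.add_sum_erase _ (F i) (Finset.mem_univ i)]
      · have e2 : F i i = 0 := by simp [hF]
        rw [e2, zero_add, Function.update_self, ← Fin.cons_update, Function.update_idem]
        congr 1
        refine Finset.sum_congr rfl fun j hj => ?_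
        have hji : j ≠ i := Finset.ne_of_mem_erase hj
        rw [Function.update_of_ne hji, ← Fin.cons_update, hF]
        simp [hji.symm]
      · intro a
        refine Fin.cases (hN i) (fun j => ?_) a
        by_cases h : j = i
        · subst h; simpa using hV
        · simpa [h] using hY j
    · intro a
      refine Fin.cases dν (fun j => ?_) a
      by_cases h : j = i
      · subst h; simpa using dV
      · simpa [h] using dY j
  -- By ∂ᵢYⱼ = ∂ⱼYᵢ the two determinants differ only by exchanging slots i and j.
  have anti : ∀ i j, F i j = -F j i := by
    intro i j
    by_cases h : i = j
    · simp [hF, h]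
    · simp only [hF, if_neg h, if_neg (Ne.symm h)]
      rw [hsymm i j]
      have hs : (Fin.succ i : Fin (n + 1)) ≠ j.succ := fun h' => h (Fin.succ_injective _ h')
      rw [← AlternatingMap.map_swap (vol (n + 1)) _ hs]
      congr 1
      ext1 a
      refine Fin.cases ?_ (fun k => ?_) a
      · simp [Equiv.swap_apply_of_ne_of_ne (Fin.succ_ne_zero i).symm (Fin.succ_ne_zero j).symm,
          (Fin.succ_ne_zero _).symm]
      · by_cases h1 : k = i
        · subst h1; simp [h, hs.symm]
        · by_cases h2 : k = j
          · subst h2; simp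
          · have : (Equiv.swap i.succ j.succ) k.succ = k.succ :=
              Equiv.swap_apply_of_ne_of_ne (fun h' => h1 (Fin.succ_injective _ h'))
                (fun h' => h2 (Fin.succ_injective _ h'))
            simp [this, h1, h2]
  have hzero : ∑ i, ∑ j, F i j = 0 := by
    have h1 : ∑ i, ∑ j, F i j = -∑ i, ∑ j, F i j := by
      conv_lhs => rw [Finset.sum_comm]
      rw [← Finset.sum_neg_distrib]
      refine Finset.sum_congr rfl fun i _ => ?_
      rw [← Finset.sum_neg_distrib]
      exact Finset.sum_congr rfl fun j _ => anti j i
    linarith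
  simp_rw [key]
  rw [Finset.sum_add_distrib, hzero, add_zero]

/-- Symmetry of second derivatives persists at boundary points because they are limits of interior
points. -/
lemma pd_comm {F : Type*} [NormedAddCommGroup F] [NormedSpace ℝ F] {f : E n → F} {p : E n}
    (hp : p ∈ cball n) (hf : ContDiffOn ℝ ∞ f (cball n)) (i j : Fin n) :
    pd i (pd j f) p = pd j (pd i f) p := by
  have hd : DifferentiableWithinAt ℝ (fderivWithin ℝ f (cball n)) (cball n) p :=
    (hf.fderivWithin (m := 1) uniqueDiffOn_cball (by norm_cast)).differentiableOn (by simp) p hp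
  have key : ∀ i j : Fin n, pd i (pd j f) p =
      fderivWithin ℝ (fderivWithin ℝ f (cball n)) (cball n) p (EuclideanSpace.single i 1)
        (EuclideanSpace.single j 1) := by
    intro i j
    have h := hd.hasFDerivWithinAt.clm_apply
      (hasFDerivWithinAt_const (EuclideanSpace.single j (1 : ℝ)) p (cball n))
    change fderivWithin ℝ (fun q => fderivWithin ℝ f (cball n) q (EuclideanSpace.single j 1)) _ _ _
      = _
    rw [h.fderivWithin (uniqueDiffOn_cball p hp)]
    simp
  rw [key, key]
  have hc : p ∈ closure (interior (cball n)) := by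
    rw [interior_closedBall _ one_ne_zero, closure_ball _ one_ne_zero]; exact hp
  exact ContDiffWithinAt.isSymmSndFDerivWithinAt (n := 2) ((hf p hp).of_le (by norm_cast))
    (by simp) uniqueDiffOn_cball hc hp _ _

end

/-! ### Linear algebra of the tangent frame and of adjugates. -/

section

open Matrix

/-- Replacing a column by a tangential vector (up to normal part) in the determinant. -/
lemma vol_cons_update {X : Fin n → E (n + 1)} {ν : E (n + 1)} (M : Matrix (Fin n) (Fin n) ℝ)
    (τ : Fin n → ℝ) (r : ℝ) (i : Fin n) :
    vol (n + 1) (Fin.cons ν (Function.update (fun j => ∑ k, M k j • X k) i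
      (∑ k, τ k • X k + r • ν))) = vol (n + 1) (Fin.cons ν X) * (M.adjugate *ᵥ τ) i := by
  have h1 : vol (n + 1) (Fin.cons ν (Function.update (fun j => ∑ k, M k j • X k) i
      (∑ k, τ k • X k + r • ν))) = vol (n + 1) (Fin.cons ν (Function.update
        (fun j => ∑ k, M k j • X k) i (∑ k, τ k • X k))) := by
    rw [Fin.cons_update, Fin.cons_update, AlternatingMap.map_update_add,
      AlternatingMap.map_update_smul]
    -- The normal part contributes nothing: ν would occur twice.
    have : (vol (n + 1)) (Function.update (Fin.cons ν fun j => ∑ k, M k j • X k :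
        Fin (n + 1) → E (n + 1)) i.succ ν) = 0 := by
      refine AlternatingMap.map_eq_zero_of_eq _ _ (i := 0) (j := i.succ) ?_ (Fin.succ_ne_zero i).symm
      rw [Function.update_self, Function.update_of_ne (Fin.succ_ne_zero i).symm, Fin.cons_zero]
    rw [this, smul_zero, add_zero]
  rw [h1]
  -- In frame coordinates this is an alternating n-form on ℝⁿ, hence a multiple of the determinant;
  -- Cramer's rule then produces the adjugate.
  set α : (Fin n → ℝ) [⋀^Fin n]→ₗ[ℝ] ℝ := ((vol (n + 1)).curryLeft ν).compLinearMap
    (Fintype.linearCombination ℝ X) with hα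
  have hα' : ∀ v : Fin n → Fin n → ℝ,
      α v = vol (n + 1) (Fin.cons ν fun j => ∑ k, v j k • X k) := fun v => rfl
  have h2 := α.eq_smul_basis_det (Pi.basisFun ℝ (Fin n))
  have h3 : α (Pi.basisFun ℝ (Fin n)) = vol (n + 1) (Fin.cons ν X) := by
    rw [hα']
    congr 2
    ext1 j
    simp [Pi.single_apply]
  have h4 : (Function.update (fun j => ∑ k, M k j • X k) i (∑ k, τ k • X k)) =
      fun j => ∑ k, (Mᵀ.updateRow i τ) j k • X k := by
    ext1 j
    by_cases h : j = i
    · subst h; simp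
    · simp [h]
  rw [h4]
  refine ((hα' (Mᵀ.updateRow i τ)).symm.trans (DFunLike.congr_fun h2 _)).trans ?_
  change α _ * (Pi.basisFun ℝ (Fin n)).det (fun j k => Mᵀ.updateRow i τ j k) = _
  rw [Pi.basisFun_det_apply, h3, ← cramer_eq_adjugate_mulVec, ← transpose_transpose M,
    cramer_transpose_apply, transpose_transpose]
  rfl

/-- The squared determinant of the tangent frame and the unit normal is the Gram determinant. -/
lemma vol_cons_sq {X : Fin n → E (n + 1)} {ν : E (n + 1)} (hν : ‖ν‖ = 1)
    (hX : ∀ i, inner ℝ (X i) ν = 0) :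
    vol (n + 1) (Fin.cons ν X) ^ 2 = (gram ℝ X).det := by
  set Q : Matrix (Fin (n + 1)) (Fin (n + 1)) ℝ :=
    Matrix.of fun i j => (Fin.cons ν X : Fin (n + 1) → E (n + 1)) i j with hQ
  have h1 : vol (n + 1) (Fin.cons ν X) ^ 2 = (Q * Qᵀ).det := by
    rw [det_mul, det_transpose, vol_apply, sq]
  have h2 : Q * Qᵀ = gram ℝ (Fin.cons ν X : Fin (n + 1) → E (n + 1)) := by
    ext i j
    rw [mul_apply, gram_apply, PiLp.inner_apply]
    exact Finset.sum_congr rfl fun k _ => by simp [hQ, mul_comm]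
  rw [h1, h2, det_succ_row_zero, Fin.sum_univ_succ]
  have h3 : ∀ j : Fin n, gram ℝ (Fin.cons ν X : Fin (n + 1) → E (n + 1)) 0 j.succ = 0 := by
    intro j
    rw [gram_apply, Fin.cons_zero, Fin.cons_succ, real_inner_comm, hX]
  have h4 : gram ℝ (Fin.cons ν X : Fin (n + 1) → E (n + 1)) 0 0 = 1 := by
    simp [gram_apply, hν]
  simp only [h3, h4]
  simp
  rfl

lemma vol_cons_ne_zero {X : Fin n → E (n + 1)} {ν : E (n + 1)} (hν : ‖ν‖ = 1)
    (hX : ∀ i, inner ℝ (X i) ν = 0) (hg : (gram ℝ X).det ≠ 0) :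
    vol (n + 1) (Fin.cons ν X) ≠ 0 := by
  intro h
  apply hg
  rw [← vol_cons_sq hν hX, h]; simp

/-- The coefficients of the tangential part of a vector. -/
def tangentCoeff (X : Fin n → E (n + 1)) (u : E (n + 1)) : Fin n → ℝ :=
  (gram ℝ X)⁻¹ *ᵥ fun k => inner ℝ (X k) u

lemma gram_mulVec_tangentCoeff {X : Fin n → E (n + 1)} (hg : (gram ℝ X).det ≠ 0)
    (u : E (n + 1)) : gram ℝ X *ᵥ tangentCoeff X u = fun k => inner ℝ (X k) u := by
  rw [tangentCoeff, mulVec_mulVec, mul_nonsing_inv _ (isUnit_iff_ne_zero.2 hg), one_mulVec]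

lemma inner_sum_smul (X : Fin n → E (n + 1)) (a : Fin n → ℝ) (k : Fin n) :
    inner ℝ (X k) (∑ j, a j • X j) = (gram ℝ X *ᵥ a) k := by
  simp [inner_sum, inner_smul_right, mulVec, dotProduct, gram_apply, mul_comm]

/-- The difference of the two sides is orthogonal to ν and to every Xₖ; were it nonzero, the
determinant of the frame would vanish. -/
lemma eq_sum_tangentCoeff {X : Fin n → E (n + 1)} {ν : E (n + 1)} (hν : ‖ν‖ = 1)
    (hX : ∀ i, inner ℝ (X i) ν = 0) (hg : (gram ℝ X).det ≠ 0) (u : E (n + 1)) :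
    u = ∑ k, tangentCoeff X u k • X k + inner ℝ u ν • ν := by
  rw [← sub_eq_zero]
  by_contra hr
  refine vol_cons_ne_zero hν hX hg (vol_eq_zero_of_inner_eq_zero hr fun a => ?_)
  refine Fin.cases ?_ (fun k => ?_) a
  · have : ∀ k, inner ℝ ν (X k) = 0 := fun k => by rw [real_inner_comm, hX]
    simp [inner_sub_right, inner_add_right, inner_sum, inner_smul_right, this, hν,
      real_inner_comm]
  · rw [Fin.cons_succ, inner_sub_right, inner_add_right, inner_sum_smul,
      gram_mulVec_tangentCoeff hg, inner_smul_right, hX]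
    simp

/-- If `g` and `g M` are symmetric, so is `g * adj M`. -/
lemma isSymm_mul_adjugate {g M : Matrix (Fin n) (Fin n) ℝ} (hg : g.IsSymm) (hdet : g.det ≠ 0)
    (h : (g * M).IsSymm) : (g * M.adjugate).IsSymm := by
  -- The adjugate of the symmetric matrix gM is symmetric; multiplying by g on both sides and using
  -- g adj g = det g then allows cancelling det g.
  have h1 : M.adjugate * g.adjugate = g.adjugate * M.adjugateᵀ := by
    rw [← adjugate_mul_distrib, ← h.adjugate.eq, adjugate_mul_distrib, transpose_mul,
      hg.adjugate.eq]
  have h2 : g * (M.adjugate * g.adjugate) * g = g * (g.adjugate * M.adjugateᵀ) * g := by rw [h1]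
  rw [← Matrix.mul_assoc g g.adjugate, mul_adjugate, Matrix.mul_assoc, Matrix.mul_assoc,
    adjugate_mul] at h2
  simp only [Matrix.mul_smul, Matrix.mul_one, Matrix.smul_mul, Matrix.one_mul] at h2
  have h3 := smul_right_injective _ hdet h2
  rw [IsSymm, transpose_mul, hg.eq, h3]

lemma mul_adjugate_one_add_smul_comm (A : Matrix (Fin n) (Fin n) ℝ) (t : ℝ) :
    A * (1 + t • A).adjugate = (1 + t • A).adjugate * A := by
  by_cases ht : t = 0
  · subst ht; simp
  · have h := (mul_adjugate (1 + t • A)).trans (adjugate_mul (1 + t • A)).symm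
    rw [Matrix.add_mul, Matrix.mul_add, Matrix.one_mul, Matrix.mul_one, Matrix.smul_mul,
      Matrix.mul_smul] at h
    exact smul_right_injective _ ht (add_left_cancel h)

/-- An eigen-covector of `M` is an eigen-covector of the adjugate. -/
lemma dotProduct_adjugate_mulVec_eq_zero {M : Matrix (Fin n) (Fin n) ℝ} {l τ : Fin n → ℝ} {m : ℝ}
    (hl : l ᵥ* M = m • l) (h : l ⬝ᵥ τ = 0) : l ⬝ᵥ (M.adjugate *ᵥ τ) = 0 := by
  -- Perturbing M by s makes the eigenvalue m + s nonzero for s ≠ -m, where (m + s) f(s) = det(M +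
  -- s) (l · τ) = 0. Continuity covers the case m = 0.
  set f : ℝ → ℝ := fun s => l ⬝ᵥ ((M + s • (1 : Matrix (Fin n) (Fin n) ℝ)).adjugate *ᵥ τ) with hf
  have hc : Continuous f := by
    have : Continuous fun s : ℝ => (M + s • (1 : Matrix (Fin n) (Fin n) ℝ)).adjugate :=
      Continuous.matrix_adjugate (by fun_prop)
    exact Continuous.dotProduct continuous_const (this.matrix_mulVec continuous_const)
  have h0 : Set.EqOn f 0 {-m}ᶜ := by
    intro s hs
    have hms : m + s ≠ 0 := fun h' => hs (by simp; linarith)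
    have e1 : l ᵥ* (M + s • (1 : Matrix (Fin n) (Fin n) ℝ)) = (m + s) • l := by
      rw [vecMul_add, hl, vecMul_smul, vecMul_one, add_smul]
    have e2 : (m + s) * f s = 0 := by
      rw [hf, ← smul_eq_mul, ← smul_dotProduct, ← e1, dotProduct_mulVec, vecMul_vecMul,
        mul_adjugate, vecMul_smul, vecMul_one, smul_dotProduct, h, smul_zero]
    simpa [hms] using e2
  have : f 0 = 0 := congrFun (hc.ext_on (dense_compl_singleton (-m)) continuous_const h0) 0
  simpa [hf] using this

end

/-! ### Elementary symmetric functions and the pointwise identity. -/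

section

open Matrix

open scoped MatrixOrder Matrix.Norms.L2Operator in
-- With g⁻¹ = BᵀB the characteristic polynomial equals that of the symmetric matrix BhBᵀ. Thus the
-- multiset of real roots contains all n principal curvatures.
lemma splits_charpoly_inv_mul {g h : Matrix (Fin n) (Fin n) ℝ} (hg : g.PosDef) (hh : h.IsSymm) :
    (g⁻¹ * h).charpoly.Splits := by
  obtain ⟨B, hB⟩ : ∃ B : Matrix (Fin n) (Fin n) ℝ, g⁻¹ = Bᴴ * B :=
    CStarAlgebra.nonneg_iff_eq_star_mul_self.mp hg.inv.posSemidef.nonneg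
  rw [hB, Matrix.mul_assoc, charpoly_mul_comm]
  have : (B * h * Bᴴ).IsHermitian := by
    have h' : hᴴ = h := by rw [conjTranspose_eq_transpose_of_trivial, hh.eq]
    rw [IsHermitian, conjTranspose_mul, conjTranspose_mul, conjTranspose_conjTranspose, h',
      Matrix.mul_assoc]
  exact this.splits_charpoly

lemma card_roots_charpoly {A : Matrix (Fin n) (Fin n) ℝ} (hA : A.charpoly.Splits) :
    Multiset.card A.charpoly.roots = n := by
  rw [← hA.natDegree_eq_card_roots, charpoly_natDegree_eq_dim, Fintype.card_fin]

lemma esymm_roots_charpoly {A : Matrix (Fin n) (Fin n) ℝ} (hA : A.charpoly.Splits) {k : ℕ}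
    (hk : k ≤ n) : A.charpoly.roots.esymm k = (-1) ^ k * A.charpoly.coeff (n - k) := by
  have hd : A.charpoly.natDegree = n := by rw [charpoly_natDegree_eq_dim, Fintype.card_fin]
  rw [Polynomial.coeff_eq_esymm_roots_of_splits hA (by omega), hd, A.charpoly_monic.leadingCoeff,
    one_mul, Nat.sub_sub_self hk, ← mul_assoc, ← mul_pow]
  simp

lemma det_one_add_smul {A : Matrix (Fin n) (Fin n) ℝ} (hA : A.charpoly.Splits) (t : ℝ) :
    (1 + t • A).det = ∑ k ∈ Finset.range (n + 1), A.charpoly.roots.esymm k * t ^ k := by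
  by_cases ht : t = 0
  · subst ht
    rw [Finset.sum_range_succ']
    simp [Multiset.esymm]
  -- For t ≠ 0, det(1 + tA) is (-t)ⁿ times the characteristic polynomial at -1/t.
  · have h1 : A.charpoly.eval (-t⁻¹) = (scalar (Fin n) (-t⁻¹) - A).det := eval_charpoly _ _
    have h2 : (1 + t • A) = (-t) • (scalar (Fin n) (-t⁻¹) - A) := by
      ext i j
      by_cases h : i = j
      · subst h; simp [mul_sub, ht]
      · simp [h]
    have h3 : A.charpoly = (A.charpoly.roots.map fun a => Polynomial.X - Polynomial.C a).prod :=
      hA.eq_prod_roots_of_monic A.charpoly_monic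
    rw [Multiset.prod_X_sub_X_eq_sum_esymm, card_roots_charpoly hA] at h3
    rw [h2, det_smul, ← h1, h3, Polynomial.eval_finsetSum, Finset.mul_sum, Fintype.card_fin, ← h3]
    refine Finset.sum_congr rfl fun k hk => ?_
    have hk : k ≤ n := by simpa [Nat.lt_succ_iff] using hk
    obtain ⟨m, rfl⟩ := Nat.exists_eq_add_of_le hk
    simp only [Polynomial.eval_mul, Polynomial.eval_pow, Polynomial.eval_neg, Polynomial.eval_one,
      Polynomial.eval_C, Polynomial.eval_X, Nat.add_sub_cancel_left]
    rw [pow_add]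
    have e1 : (-t) ^ m * (-t⁻¹) ^ m = 1 := by rw [← mul_pow]; simp [ht]
    have e2 : (-t) ^ k * (-1) ^ k = t ^ k := by rw [← mul_pow]; simp
    linear_combination (((-t) ^ k * (-1) ^ k) * A.charpoly.roots.esymm k) * e1 +
      A.charpoly.roots.esymm k * e2

/-- Jacobi's formula: differentiate row by row and evaluate each determinant with one row replaced
by Cramer's rule. -/
lemma hasDerivAt_det_one_add_smul (A : Matrix (Fin n) (Fin n) ℝ) (t : ℝ) :
    HasDerivAt (fun s : ℝ => (1 + s • A).det) (((1 + t • A).adjugate * A).trace) t := by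
  set Z : Fin n → ℝ → E n := fun a s => WithLp.toLp 2 ((1 + s • A) a) with hZ
  have hd : ∀ a, HasDerivAt (Z a) (WithLp.toLp 2 (A a)) t := by
    intro a
    have e : Z a = fun s => WithLp.toLp 2 ((1 : Matrix (Fin n) (Fin n) ℝ) a) +
        s • (WithLp.toLp 2 (A a) : E n) := by
      ext s k; simp [hZ]
    rw [e]
    simpa using ((hasDerivAt_id t).smul_const (WithLp.toLp 2 (A a) : E n)).const_add
      (WithLp.toLp 2 ((1 : Matrix (Fin n) (Fin n) ℝ) a))
  have h := (HasFDerivAt.multilinear_comp (volCont n) fun a => (hd a).hasFDerivAt).hasDerivAt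
  refine h.congr_deriv ?_
  simp only [_root_.sum_apply, ContinuousLinearMap.comp_apply, volCont_apply,
    ContinuousMultilinearMap.toContinuousLinearMap_apply, ContinuousLinearMap.toSpanSingleton_apply,
    one_smul, trace, diag_apply]
  have e : ∀ a, vol n (Function.update (fun j => Z j t) a (WithLp.toLp 2 (A a))) =
      ∑ k, (1 + t • A).adjugate k a * A a k := by
    intro a
    have : vol n (Function.update (fun j => Z j t) a (WithLp.toLp 2 (A a))) =
        ((1 + t • A).updateRow a (A a)).det := by
      rw [vol_apply]
      congr 1
      ext i j
      by_cases hi : i = a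
      · subst hi; simp
      · simp [hi, hZ]
    rw [this, ← cramer_transpose_apply, cramer_eq_adjugate_mulVec, ← adjugate_transpose]
    rfl
  simp_rw [e, mul_apply]
  exact Finset.sum_comm

/-- The traces of the adjugate in terms of the elementary symmetric functions of the
eigenvalues. -/
lemma trace_adjugate_combination {A : Matrix (Fin n) (Fin n) ℝ} (hA : A.charpoly.Splits)
    (t q r : ℝ) :
    q * ((1 + t • A).adjugate).trace - r * ((1 + t • A).adjugate * A).trace =
      ∑ k ∈ Finset.range n, t ^ k * (q * ((n - k : ℝ) * A.charpoly.roots.esymm k) -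
        r * ((k + 1 : ℝ) * A.charpoly.roots.esymm (k + 1))) := by
  set σ := A.charpoly.roots.esymm with hσ
  have h1 : ((1 + t • A).adjugate * A).trace =
      ∑ k ∈ Finset.range n, t ^ k * ((k + 1 : ℝ) * σ (k + 1)) := by
    have h := hasDerivAt_det_one_add_smul A t
    have e : (fun s : ℝ => (1 + s • A).det) =
        fun s => ∑ k ∈ Finset.range (n + 1), σ k * s ^ k := funext (det_one_add_smul hA)
    rw [e] at h
    have h' : HasDerivAt (fun s : ℝ => ∑ k ∈ Finset.range (n + 1), σ k * s ^ k)
        (∑ k ∈ Finset.range (n + 1), σ k * (k * t ^ (k - 1))) t :=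
      HasDerivAt.fun_sum fun k _ => (hasDerivAt_pow k t).const_mul (σ k)
    rw [h.unique h', Finset.sum_range_succ']
    simp only [Nat.cast_zero, zero_mul, mul_zero, add_zero, Nat.add_sub_cancel]
    refine Finset.sum_congr rfl fun k _ => ?_
    push_cast; ring
  -- The trace of adj(M)M = det M · 1 for M = 1 + tA; it yields tr adj M from the trace just found.
  have h2 : (1 + t • A).adjugate.trace + t * ((1 + t • A).adjugate * A).trace =
      n * (1 + t • A).det := by
    have := congrArg trace (adjugate_mul (1 + t • A))
    rw [Matrix.mul_add, Matrix.mul_one, Matrix.mul_smul, trace_add, trace_smul, trace_smul,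
      trace_one, Fintype.card_fin] at this
    simpa [mul_comm] using this
  have h3 : (1 + t • A).adjugate.trace = ∑ k ∈ Finset.range n, t ^ k * ((n - k : ℝ) * σ k) := by
    have e1 : ∑ k ∈ Finset.range n, t ^ k * ((n - k : ℝ) * σ k) =
        ∑ k ∈ Finset.range (n + 1), t ^ k * ((n - k : ℝ) * σ k) := by
      rw [Finset.sum_range_succ]; simp
    have e2 : t * ∑ k ∈ Finset.range n, t ^ k * ((k + 1 : ℝ) * σ (k + 1)) =
        ∑ k ∈ Finset.range (n + 1), t ^ k * (k * σ k) := by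
      rw [Finset.sum_range_succ', Finset.mul_sum]
      simp only [Nat.cast_zero, zero_mul, mul_zero, add_zero]
      refine Finset.sum_congr rfl fun k _ => ?_
      push_cast; ring
    rw [h1, e2, det_one_add_smul hA, ← hσ] at h2
    rw [e1, eq_sub_of_add_eq h2, Finset.mul_sum, ← Finset.sum_sub_distrib]
    exact Finset.sum_congr rfl fun k _ => by ring
  rw [h1, h3, Finset.mul_sum, Finset.mul_sum, ← Finset.sum_sub_distrib]
  exact Finset.sum_congr rfl fun k _ => by ring

lemma dotProduct_mulVec_comm_of_isSymm {S : Matrix (Fin n) (Fin n) ℝ} (hS : S.IsSymm) (a b : Fin n → ℝ) :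
    a ⬝ᵥ (S *ᵥ b) = b ⬝ᵥ (S *ᵥ a) := by
  rw [dotProduct_mulVec, ← mulVec_transpose, hS.eq, dotProduct_comm]

/-- The algebraic core of the Minkowski formula at a point. -/
lemma sum_vol_update_eq {X N U : Fin n → E (n + 1)} {ν : E (n + 1)} (hν : ‖ν‖ = 1)
    (hX : ∀ i, inner ℝ (X i) ν = 0) (hg : (gram ℝ X).det ≠ 0)
    {A : Matrix (Fin n) (Fin n) ℝ} (hA : (gram ℝ X * A).IsSymm)
    (hN : ∀ j, N j = ∑ k, A k j • X k) (x e : E (n + 1)) (c q r t : ℝ) (s : Fin n → ℝ)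
    (hU : ∀ i, U i = inner ℝ (X i) e • x - inner ℝ (X i) x • e + q • X i - r • N i +
      c • (inner ℝ (N i) e • x - inner ℝ (N i) x • e) + s i • ν) :
    ∑ i, vol (n + 1) (Fin.cons ν (Function.update (fun j => X j + t • N j) i (U i))) =
      vol (n + 1) (Fin.cons ν X) *
        (q * ((1 + t • A).adjugate).trace - r * ((1 + t • A).adjugate * A).trace) := by
  set g := gram ℝ X with hg_def
  have gs : g.IsSymm := by
    ext i j; simp [hg_def, gram_apply, real_inner_comm]
  set M := 1 + t • A with hM
  set a := tangentCoeff X x with ha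
  set b := tangentCoeff X e with hb
  have xa := eq_sum_tangentCoeff hν hX hg x
  have eb := eq_sum_tangentCoeff hν hX hg e
  rw [← ha] at xa
  rw [← hb] at eb
  have Xi : ∀ u i, inner ℝ (X i) u = (g *ᵥ tangentCoeff X u) i := fun u i =>
    (congrFun (gram_mulVec_tangentCoeff hg u) i).symm
  have Ni : ∀ u i, inner ℝ (N i) u = ((g * A) *ᵥ tangentCoeff X u) i := by
    intro u i
    rw [← hA.eq, transpose_mul, ← mulVec_mulVec, gs.eq, hN, sum_inner]
    simp_rw [inner_smul_left, Xi]
    rfl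
  have hY : (fun j => X j + t • N j) = fun j => ∑ k, M k j • X k := by
    ext1 j
    simp only [hM, Matrix.add_apply, Matrix.smul_apply, add_smul, Finset.sum_add_distrib, hN,
      Finset.smul_sum, smul_smul, smul_eq_mul]
    congr 1
    simp [Matrix.one_apply]
  -- `τ i` holds the frame coordinates of the tangential part of `U i`; a and b are those of x and
  -- e.
  set τ : Fin n → Fin n → ℝ := fun i => ((g *ᵥ b) i • a - (g *ᵥ a) i • b) + q • Pi.single i 1 -
    r • A.col i + c • (((g * A) *ᵥ b) i • a - ((g * A) *ᵥ a) i • b) with hτ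
  have hUτ : ∀ i, ∃ ρ : ℝ, U i = ∑ k, τ i k • X k + ρ • ν := by
    intro i
    refine ⟨(g *ᵥ b) i * inner ℝ x ν - (g *ᵥ a) i * inner ℝ e ν +
      c * (((g * A) *ᵥ b) i * inner ℝ x ν - ((g * A) *ᵥ a) i * inner ℝ e ν) + s i, ?_⟩
    have e0 : ∑ k, τ i k • X k = (g *ᵥ b) i • ∑ k, a k • X k - (g *ᵥ a) i • ∑ k, b k • X k +
        q • X i - r • ∑ k, A k i • X k +
        c • (((g * A) *ᵥ b) i • ∑ k, a k • X k - ((g * A) *ᵥ a) i • ∑ k, b k • X k) := by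
      have e1 : X i = ∑ k, (Pi.single i (1 : ℝ) : Fin n → ℝ) k • X k := by
        simp [Pi.single_apply]
      conv_rhs => rw [e1]
      simp only [Finset.smul_sum, ← Finset.sum_sub_distrib, ← Finset.sum_add_distrib]
      refine Finset.sum_congr rfl fun k _ => ?_
      simp only [hτ, Pi.add_apply, Pi.sub_apply, Pi.smul_apply, smul_eq_mul, col_apply]
      module
    rw [e0, hU, eq_sub_of_add_eq xa.symm, eq_sub_of_add_eq eb.symm, ← hN i, Ni, Ni, Xi, Xi,
      ← ha, ← hb]
    module
  have key : ∀ i, vol (n + 1) (Fin.cons ν (Function.update (fun j => X j + t • N j) i (U i))) =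
      vol (n + 1) (Fin.cons ν X) * (M.adjugate *ᵥ τ i) i := by
    intro i
    obtain ⟨ρ, hρ⟩ := hUτ i
    rw [hY, hρ, vol_cons_update]
  simp_rw [key]
  rw [← Finset.mul_sum]
  congr 1
  have expand : ∀ i, (M.adjugate *ᵥ τ i) i =
      ((g *ᵥ b) i * (M.adjugate *ᵥ a) i - (g *ᵥ a) i * (M.adjugate *ᵥ b) i) +
      q * M.adjugate i i - r * (M.adjugate * A) i i +
      c * (((g * A) *ᵥ b) i * (M.adjugate *ᵥ a) i - ((g * A) *ᵥ a) i * (M.adjugate *ᵥ b) i) := by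
    intro i
    have : (M.adjugate *ᵥ A.col i) i = (M.adjugate * A) i i := rfl
    simp only [hτ, mulVec_add, mulVec_sub, mulVec_smul, Pi.add_apply, Pi.sub_apply, Pi.smul_apply,
      smul_eq_mul, this, mulVec_single_one, col_apply]
  simp only [expand, Finset.sum_add_distrib, Finset.sum_sub_distrib, ← Finset.mul_sum]
  have hgM : (g * M).IsSymm := by
    rw [hM, Matrix.mul_add, Matrix.mul_one, Matrix.mul_smul]
    exact gs.add (hA.smul t)
  have hS := isSymm_mul_adjugate gs hg hgM
  have hS' : (g * A * M.adjugate).IsSymm := by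
    have : g * A * M.adjugate = g * M.adjugate * A := by
      rw [Matrix.mul_assoc, hM, mul_adjugate_one_add_smul_comm, ← Matrix.mul_assoc]
    rw [IsSymm]
    conv_lhs => rw [this]
    rw [transpose_mul, hS.eq, ← Matrix.mul_assoc, ← gs.eq, ← transpose_mul, gs.eq, hA.eq]
  -- The terms in x and e are skew in (a, b), while g adj M and gA adj M are symmetric, so they drop
  -- out of the sum.
  have s1 : ∑ i, (g *ᵥ b) i * (M.adjugate *ᵥ a) i = ∑ i, (g *ᵥ a) i * (M.adjugate *ᵥ b) i := by
    have h1 : ∀ u v : Fin n → ℝ, ∑ i, (g *ᵥ u) i * (M.adjugate *ᵥ v) i =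
        u ⬝ᵥ ((g * M.adjugate) *ᵥ v) := by
      intro u v
      rw [← mulVec_mulVec, dotProduct_mulVec, ← mulVec_transpose, gs.eq]; rfl
    rw [h1, h1, dotProduct_mulVec_comm_of_isSymm hS]
  have s2 : ∑ i, ((g * A) *ᵥ b) i * (M.adjugate *ᵥ a) i =
      ∑ i, ((g * A) *ᵥ a) i * (M.adjugate *ᵥ b) i := by
    have h1 : ∀ u v : Fin n → ℝ, ∑ i, ((g * A) *ᵥ u) i * (M.adjugate *ᵥ v) i =
        u ⬝ᵥ ((g * A * M.adjugate) *ᵥ v) := by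
      intro u v
      rw [← mulVec_mulVec _ (g * A), dotProduct_mulVec, ← mulVec_transpose, hA.eq]; rfl
    rw [h1, h1, dotProduct_mulVec_comm_of_isSymm hS']
  rw [s1, s2, sub_self, sub_self, mul_zero, zero_add, add_zero]
  rfl

end

/-! ### Geometry of the hypersurface and the Minkowski field. -/

section

open Matrix

section Rules

variable {F : Type*} [NormedAddCommGroup F] [NormedSpace ℝ F] {p : E n} {i : Fin n}

lemma pd_add {f g : E n → F} (hp : p ∈ cball n) (hf : DifferentiableWithinAt ℝ f (cball n) p)
    (hg : DifferentiableWithinAt ℝ g (cball n) p) :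
    pd i (fun q => f q + g q) p = pd i f p + pd i g p := by
  unfold pd
  rw [fderivWithin_fun_add (uniqueDiffOn_cball p hp) hf hg]; rfl

lemma pd_sub {f g : E n → F} (hp : p ∈ cball n) (hf : DifferentiableWithinAt ℝ f (cball n) p)
    (hg : DifferentiableWithinAt ℝ g (cball n) p) :
    pd i (fun q => f q - g q) p = pd i f p - pd i g p := by
  unfold pd
  rw [fderivWithin_fun_sub (uniqueDiffOn_cball p hp) hf hg]; rfl

lemma pd_smul {a : E n → ℝ} {g : E n → F} (hp : p ∈ cball n)
    (ha : DifferentiableWithinAt ℝ a (cball n) p) (hg : DifferentiableWithinAt ℝ g (cball n) p) :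
    pd i (fun q => a q • g q) p = a p • pd i g p + pd i a p • g p := by
  unfold pd
  rw [fderivWithin_fun_smul (uniqueDiffOn_cball p hp) ha hg]; rfl

lemma pd_const (u : F) : pd i (fun _ : E n => u) p = 0 := by
  unfold pd
  rw [fderivWithin_fun_const]; rfl

lemma pd_inner {m : ℕ} {f g : E n → E m} (hp : p ∈ cball n)
    (hf : DifferentiableWithinAt ℝ f (cball n) p) (hg : DifferentiableWithinAt ℝ g (cball n) p) :
    pd i (fun q => (inner ℝ (f q) (g q) : ℝ)) p =
      inner ℝ (f p) (pd i g p) + inner ℝ (pd i f p) (g p) := by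
  unfold pd
  rw [(hf.hasFDerivWithinAt.inner ℝ hg.hasFDerivWithinAt).fderivWithin (uniqueDiffOn_cball p hp)]
  simp

lemma pd_eq_zero_of_eqOn_const {f : E n → F} {u : F} (hp : p ∈ cball n)
    (h : ∀ q ∈ cball n, f q = u) : pd i f p = 0 := by
  have : fderivWithin ℝ f (cball n) p = fderivWithin ℝ (fun _ => u) (cball n) p :=
    fderivWithin_congr h (h p hp)
  unfold pd
  rw [this]
  exact pd_const u

lemma fderivWithin_apply_eq_sum (f : E n → F) (p v : E n) :
    fderivWithin ℝ f (cball n) p v = ∑ i, v i • pd i f p := by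
  conv_lhs => rw [← (EuclideanSpace.basisFun (Fin n) ℝ).sum_repr v]
  simp [pd]

end Rules

lemma contDiff_confField {m : ℕ} (e : E m) : ContDiff ℝ ∞ (confField e) := by
  unfold confField
  exact ((contDiff_id.inner ℝ contDiff_const).smul contDiff_id).sub
    ((((contDiff_id.norm_sq ℝ).add contDiff_const).div_const 2).smul contDiff_const)

lemma fderiv_confField {m : ℕ} (e y v : E m) :
    fderiv ℝ (confField e) y v = inner ℝ v e • y + inner ℝ y e • v - inner ℝ y v • e := by
  have h1 : HasFDerivAt (fun y : E m => (inner ℝ y e : ℝ)) (innerSL ℝ e) y := by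
    have := (innerSL ℝ e).hasFDerivAt (x := y)
    refine this.congr_of_eventuallyEq (Filter.Eventually.of_forall fun z => ?_)
    exact real_inner_comm e z
  have h2 := (((hasStrictFDerivAt_norm_sq y).hasFDerivAt.add_const 1).const_mul (1 / 2 : ℝ))
  have h3 := (h1.fun_smul (hasFDerivAt_id y)).fun_sub (h2.smul_const e)
  have h4 : confField e = fun z => inner ℝ z e • id z - ((1 / 2 : ℝ) * (‖z‖ ^ 2 + 1)) • e := by
    ext1 z; unfold confField; rw [id, div_eq_inv_mul, one_div]
  have h5 : HasFDerivAt (confField e) _ y := h4 ▸ h3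
  rw [h5.fderiv]
  simp only [_root_.sub_apply, _root_.add_apply,
    _root_.smul_apply, ContinuousLinearMap.smulRight_apply, innerSL_apply_apply,
    ContinuousLinearMap.id_apply, id, smul_eq_mul, nsmul_eq_mul]
  rw [real_inner_comm e v]
  module

/-- The tangential field `X_e - ⟨X_e, ν⟩ ν + c (⟨ν, e⟩ x - ⟨x, ν⟩ e)` along a hypersurface. -/
def minkowskiField (c : ℝ) (e : E (n + 1)) (x ν : E n → E (n + 1)) (q : E n) : E (n + 1) :=
  confField e (x q) - inner ℝ (confField e (x q)) (ν q) • ν q +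
    c • (inner ℝ (ν q) e • x q - inner ℝ (x q) (ν q) • e)

variable {x ν : E n → E (n + 1)} {θ : ℝ} {p : E n}

lemma contDiffOn_minkowskiField (c : ℝ) (e : E (n + 1)) (hx : ContDiffOn ℝ ∞ x (cball n))
    (hν : ContDiffOn ℝ ∞ ν (cball n)) : ContDiffOn ℝ ∞ (minkowskiField c e x ν) (cball n) := by
  have h := (contDiff_confField e).comp_contDiffOn hx
  unfold minkowskiField
  have he : ContDiffOn ℝ ∞ (fun _ : E n => e) (cball n) := contDiffOn_const
  have hc : ContDiffOn ℝ ∞ (fun _ : E n => c) (cball n) := contDiffOn_const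
  exact (h.sub ((h.inner ℝ hν).smul hν)).add (hc.smul
    (((hν.inner ℝ he).smul hx).sub ((hx.inner ℝ hν).smul he)))

/-- The right side is arranged as the `U i` of `sum_vol_update_eq`: pairs skew in x and e, multiples
of ∂ᵢx and ∂ᵢν, and a normal remainder whose value is irrelevant. -/
lemma pd_minkowskiField (c : ℝ) (e : E (n + 1)) (hp : p ∈ cball n)
    (dx : DifferentiableWithinAt ℝ x (cball n) p) (dν : DifferentiableWithinAt ℝ ν (cball n) p)
    (i : Fin n) (h : inner ℝ (pd i x p) (ν p) = 0) :
    pd i (minkowskiField c e x ν) p =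
      inner ℝ (pd i x p) e • x p - inner ℝ (pd i x p) (x p) • e +
        (inner ℝ (x p) e + c * inner ℝ (ν p) e) • pd i x p -
        inner ℝ (confField e (x p)) (ν p) • pd i ν p +
        c • (inner ℝ (pd i ν p) e • x p - inner ℝ (pd i ν p) (x p) • e) +
        (-pd i (fun q => (inner ℝ (confField e (x q)) (ν q) : ℝ)) p) • ν p := by
  have dc : DifferentiableAt ℝ (confField e) (x p) :=
    (contDiff_confField e).differentiable (by simp) _
  have dC : DifferentiableWithinAt ℝ (fun q => confField e (x q)) (cball n) p :=
    dc.comp_differentiableWithinAt p dx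
  have hC : pd i (fun q => confField e (x q)) p = fderiv ℝ (confField e) (x p) (pd i x p) := by
    unfold pd
    exact DFunLike.congr_fun ((dc.hasFDerivAt.comp_hasFDerivWithinAt p
      dx.hasFDerivWithinAt).fderivWithin (uniqueDiffOn_cball p hp)) _
  have de : DifferentiableWithinAt ℝ (fun _ : E n => e) (cball n) p :=
    differentiableWithinAt_const e
  have dc' : DifferentiableWithinAt ℝ (fun _ : E n => c) (cball n) p :=
    differentiableWithinAt_const c
  have d1 := dC.inner ℝ dν
  have d2 := dν.inner ℝ de
  have d3 := dx.inner ℝ dν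
  unfold minkowskiField
  rw [pd_add hp (dC.fun_sub (d1.fun_smul dν)) (dc'.fun_smul ((d2.fun_smul dx).fun_sub (d3.fun_smul de))),
    pd_sub hp dC (d1.fun_smul dν), pd_smul hp d1 dν,
    pd_smul hp dc' ((d2.fun_smul dx).fun_sub (d3.fun_smul de)), pd_sub hp (d2.fun_smul dx) (d3.fun_smul de),
    pd_smul hp d2 dx, pd_smul hp d3 de, pd_inner hp dν de, pd_inner hp dx dν, pd_const,
    pd_const, hC, fderiv_confField, h, inner_zero_right, real_inner_comm (x p) (pd i x p),
    real_inner_comm (x p) (pd i ν p)]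
  module

lemma inner_minkowskiField_normal (c : ℝ) (e : E (n + 1)) (h : ‖ν p‖ = 1) :
    inner ℝ (minkowskiField c e x ν p) (ν p) = 0 := by
  unfold minkowskiField
  rw [inner_add_left, inner_sub_left, inner_smul_left, inner_smul_left, inner_sub_left,
    inner_smul_left, inner_smul_left, real_inner_self_eq_norm_sq, h, real_inner_comm e (ν p)]
  simp
  right; ring

/-- On the boundary sphere the field is tangent to the sphere. -/
lemma inner_minkowskiField_position (c : ℝ) (e : E (n + 1)) (h1 : ‖x p‖ = 1)
    (hc : inner ℝ (ν p) (x p) = -c) : inner ℝ (minkowskiField c e x ν p) (x p) = 0 := by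
  have hc' : inner ℝ (x p) (ν p) = -c := by rw [real_inner_comm, hc]
  unfold minkowskiField confField
  simp only [inner_add_left, inner_sub_left, inner_smul_left, real_inner_self_eq_norm_sq, h1, hc,
    hc', real_inner_comm (x p) e, real_inner_comm (ν p) e]
  simp
  ring

lemma IsUnitNormal.inner_pd (hν : IsUnitNormal x ν) (hp : p ∈ cball n) (i : Fin n) :
    inner ℝ (pd i x p) (ν p) = 0 := hν.normal p hp _

lemma IsUnitNormal.inner_pd_self (hν : IsUnitNormal x ν) (hp : p ∈ cball n) (i : Fin n) :
    inner ℝ (pd i ν p) (ν p) = 0 := by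
  have dν := hν.smooth.differentiableOn (by simp) p hp
  have h := pd_inner (i := i) hp dν dν
  rw [pd_eq_zero_of_eqOn_const hp (u := (1 : ℝ)) fun q hq => by
    rw [real_inner_self_eq_norm_sq, hν.norm_eq_one q hq]; norm_num, real_inner_comm] at h
  linarith

/-- Differentiate ⟨∂ⱼx, ν⟩ = 0. With this sign convention for h the Weingarten equations carry no
minus sign. -/
lemma inner_pd_pd_normal (hx : IsProperEmbedding x) (hν : IsUnitNormal x ν) (hp : p ∈ cball n)
    (i j : Fin n) : inner ℝ (pd j x p) (pd i ν p) = secondFundamentalForm x ν p i j := by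
  have dν := hν.smooth.differentiableOn (by simp) p hp
  have dx : DifferentiableWithinAt ℝ (pd j x) (cball n) p :=
    (contDiffOn_pd (m := 1) hx.smooth (by norm_cast) j).differentiableOn (by simp) p hp
  have h := pd_inner (i := i) hp dx dν
  rw [pd_eq_zero_of_eqOn_const hp (u := (0 : ℝ)) fun q hq => hν.inner_pd hq j] at h
  change _ = -inner ℝ (pd i (pd j x) p) (ν p)
  linarith

lemma isSymm_secondFundamentalForm (hx : IsProperEmbedding x) (hp : p ∈ cball n) :
    (secondFundamentalForm x ν p).IsSymm := by
  ext i j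
  change -inner ℝ (pd j (pd i x) p) (ν p) = -inner ℝ (pd i (pd j x) p) (ν p)
  rw [pd_comm hp hx.smooth]

lemma metric_eq_gram (x : E n → E (n + 1)) (p : E n) :
    metric x p = gram ℝ fun i => pd i x p := rfl

lemma posDef_metric (hx : IsProperEmbedding x) (hp : p ∈ cball n) : (metric x p).PosDef := by
  rw [metric_eq_gram]
  refine posDef_gram_of_linearIndependent ?_
  have h := (EuclideanSpace.basisFun (Fin n) ℝ).toBasis.linearIndependent.map'
    (fderivWithin ℝ x (cball n) p).toLinearMap (LinearMap.ker_eq_bot.2 (hx.immersion p hp))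
  have e : (fun i => pd i x p) = (fderivWithin ℝ x (cball n) p).toLinearMap ∘
      (EuclideanSpace.basisFun (Fin n) ℝ).toBasis := by
    ext1 i
    simp [pd]
  rw [e]
  exact h

lemma det_metric_ne_zero (hx : IsProperEmbedding x) (hp : p ∈ cball n) :
    (metric x p).det ≠ 0 := (posDef_metric hx hp).det_pos.ne'

lemma metric_mul_weingarten (hx : IsProperEmbedding x) (hp : p ∈ cball n) :
    metric x p * weingarten x ν p = secondFundamentalForm x ν p := by
  rw [weingarten, ← Matrix.mul_assoc,
    mul_nonsing_inv _ (isUnit_iff_ne_zero.2 (det_metric_ne_zero hx hp)), Matrix.one_mul]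

/-- The Weingarten equations. -/
lemma pd_normal_eq (hx : IsProperEmbedding x) (hν : IsUnitNormal x ν) (hp : p ∈ cball n)
    (j : Fin n) : pd j ν p = ∑ k, weingarten x ν p k j • pd k x p := by
  have h := eq_sum_tangentCoeff (hν.norm_eq_one p hp) (hν.inner_pd hp) (det_metric_ne_zero hx hp)
    (pd j ν p)
  rw [hν.inner_pd_self hp, zero_smul, add_zero] at h
  rw [h]
  refine Finset.sum_congr rfl fun k _ => ?_
  congr 1
  unfold tangentCoeff weingarten
  simp_rw [inner_pd_pd_normal hx hν hp]
  rw [mul_apply, mulVec, dotProduct]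
  refine Finset.sum_congr rfl fun l _ => ?_
  rw [← (isSymm_secondFundamentalForm (ν := ν) hx hp).apply]
  rfl

lemma splits_weingarten (hx : IsProperEmbedding x) (hp : p ∈ cball n) :
    (weingarten x ν p).charpoly.Splits :=
  splits_charpoly_inv_mul (posDef_metric hx hp) (isSymm_secondFundamentalForm hx hp)

/-- The fluxes of the Minkowski field on the parallel hypersurface `x + t ν`. -/
def parallelFlux (c : ℝ) (e : E (n + 1)) (x ν : E n → E (n + 1)) (t : ℝ) : Fin n → E n → ℝ :=
  flux ν (minkowskiField c e x ν) fun j q => pd j x q + t • pd j ν q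

lemma contDiffOn_pd_add_smul_pd (hx : ContDiffOn ℝ ∞ x (cball n))
    (hν : ContDiffOn ℝ ∞ ν (cball n)) (t : ℝ) (j : Fin n) :
    ContDiffOn ℝ 1 (fun q => pd j x q + t • pd j ν q) (cball n) :=
  (contDiffOn_pd (m := 1) hx (by norm_cast) j).add
    ((contDiffOn_const (c := t)).smul (contDiffOn_pd (m := 1) hν (by norm_cast) j))

lemma contDiffOn_parallelFlux (c : ℝ) (e : E (n + 1)) (hx : ContDiffOn ℝ ∞ x (cball n))
    (hν : ContDiffOn ℝ ∞ ν (cball n)) (t : ℝ) (i : Fin n) :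
    ContDiffOn ℝ 1 (parallelFlux c e x ν t i) (cball n) :=
  contDiffOn_flux (hν.of_le (by norm_cast))
    ((contDiffOn_minkowskiField c e hx hν).of_le (by norm_cast))
    (fun j => contDiffOn_pd_add_smul_pd hx hν t j) i

/-- The divergence of the fluxes, expanded in powers of `t`. -/
lemma sum_pd_parallelFlux (hx : IsProperEmbedding x) (hν : IsUnitNormal x ν) (hp : p ∈ cball n)
    (c : ℝ) (e : E (n + 1)) (t : ℝ) :
    ∑ i, pd i (parallelFlux c e x ν t i) p =
      vol (n + 1) (Fin.cons (ν p) fun i => pd i x p) * ∑ k ∈ Finset.range n, t ^ k *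
        ((inner ℝ (x p) e + c * inner ℝ (ν p) e) *
          ((n - k : ℝ) * (principalCurvatures x ν p).esymm k) -
        inner ℝ (confField e (x p)) (ν p) *
          ((k + 1 : ℝ) * (principalCurvatures x ν p).esymm (k + 1))) := by
  have dx := hx.smooth.differentiableOn (by simp) p hp
  have dν := hν.smooth.differentiableOn (by simp) p hp
  have dpx : ∀ j, DifferentiableWithinAt ℝ (pd j x) (cball n) p := fun j =>
    (contDiffOn_pd (m := 1) hx.smooth (by norm_cast) j).differentiableOn (by simp) p hp
  have dpν : ∀ j, DifferentiableWithinAt ℝ (pd j ν) (cball n) p := fun j =>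
    (contDiffOn_pd (m := 1) hν.smooth (by norm_cast) j).differentiableOn (by simp) p hp
  have dt : DifferentiableWithinAt ℝ (fun _ : E n => t) (cball n) p :=
    differentiableWithinAt_const t
  have h1 := hν.norm_eq_one p hp
  unfold parallelFlux
  rw [sum_pd_flux hp dν
    ((contDiffOn_minkowskiField c e hx.smooth hν.smooth).differentiableOn (by simp) p hp)
    (fun j => (dpx j).fun_add (dt.fun_smul (dpν j))) ?_ (by intro h; simp [h] at h1) ?_
    (inner_minkowskiField_normal c e h1) (hν.inner_pd_self hp)]
  · rw [sum_vol_update_eq h1 (hν.inner_pd hp) (det_metric_ne_zero hx hp)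
      (A := weingarten x ν p) (by
        rw [← metric_eq_gram, metric_mul_weingarten hx hp]
        exact isSymm_secondFundamentalForm hx hp)
      (pd_normal_eq hx hν hp) (x p) e c _ _ t _
      (fun i => pd_minkowskiField c e hp dx dν i (hν.inner_pd hp i)),
      trace_adjugate_combination (splits_weingarten hx hp)]
    rfl
  -- Yⱼ is the partial derivative ∂ⱼ(x + tν), so ∂ᵢYⱼ is symmetric in i and j.
  · intro i j
    rw [pd_add hp (dpx j) (dt.fun_smul (dpν j)), pd_add hp (dpx i) (dt.fun_smul (dpν i)),
      pd_smul hp dt (dpν j), pd_smul hp dt (dpν i), pd_const, pd_const,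
      pd_comm hp hx.smooth, pd_comm hp hν.smooth]
    simp
  · intro j
    rw [inner_add_left, inner_smul_left, hν.inner_pd hp, hν.inner_pd_self hp]
    simp

end

/-! ### Vanishing boundary flux and integration over the hypersurface. -/

section

open Matrix MeasureTheory

variable {x ν : E n → E (n + 1)} {θ : ℝ} {p : E n}

/-- A function that is constant on the sphere has vanishing tangential derivatives there. -/
lemma fderivWithin_apply_eq_zero_of_const_on_sphere {f : E n → ℝ} {a : ℝ}
    (hp : p ∈ Metric.sphere (0 : E n) 1) (hf : DifferentiableWithinAt ℝ f (cball n) p)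
    (h : ∀ q ∈ Metric.sphere (0 : E n) 1, f q = a) {v : E n} (hv : inner ℝ p v = 0) :
    fderivWithin ℝ f (cball n) p v = 0 := by
  have unit_case : ∀ u : E n, ‖u‖ = 1 → inner ℝ p u = 0 → fderivWithin ℝ f (cball n) p u = 0 := by
    intro u hu hpu
    -- The great circle stays in the closed ball, so the chain rule applies to the one-sided
    -- derivative.
    set γ : ℝ → E n := fun s => Real.cos s • p + Real.sin s • u with hγ
    have hγs : ∀ s, γ s ∈ Metric.sphere (0 : E n) 1 := by
      intro s
      have hp1 : ‖p‖ = 1 := by simpa using hp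
      rw [mem_sphere_zero_iff_norm]
      have : ‖γ s‖ ^ 2 = 1 := by
        rw [hγ, norm_add_sq_real, norm_smul, norm_smul, inner_smul_left, inner_smul_right, hpu,
          hp1, hu]
        simp
      nlinarith [norm_nonneg (γ s)]
    have hγd : HasDerivAt γ u 0 := by
      have := ((Real.hasDerivAt_cos 0).smul_const p).fun_add ((Real.hasDerivAt_sin 0).smul_const u)
      refine this.congr_deriv ?_
      simp
    have hγ0 : γ 0 = p := by simp [hγ]
    have hd : HasFDerivWithinAt f (fderivWithin ℝ f (cball n) p) (cball n) (γ 0) := by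
      rw [hγ0]; exact hf.hasFDerivWithinAt
    have h1 := hd.comp_hasDerivAt (0 : ℝ) hγd
      (Filter.Eventually.of_forall fun s => Metric.sphere_subset_closedBall (hγs s))
    have h2 : f ∘ γ = fun _ => a := funext fun s => h _ (hγs s)
    rw [h2] at h1
    exact h1.unique (hasDerivAt_const _ _)
  by_cases hv0 : v = 0
  · simp [hv0]
  · have h1 := unit_case (‖v‖⁻¹ • v) (by simp [norm_smul, hv0]) (by simp [inner_smul_right, hv])
    rw [map_smul, smul_eq_mul] at h1
    simpa [hv0] using h1

/-- A covector on `ℝⁿ` that vanishes on the orthogonal complement of a unit vector is a multiple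
of it. -/
lemma eq_smul_of_forall_orthogonal (hp : ‖p‖ = 1) {l : Fin n → ℝ}
    (h : ∀ v : E n, inner ℝ p v = 0 → ∑ i, v i * l i = 0) : ∃ a : ℝ, l = a • fun i => p i := by
  set L : E n := WithLp.toLp 2 l with hL
  refine ⟨inner ℝ p L, ?_⟩
  set v : E n := L - (inner ℝ p L : ℝ) • p with hv
  have hpv : inner ℝ p v = 0 := by
    rw [hv, inner_sub_right, inner_smul_right, real_inner_self_eq_norm_sq, hp]; ring
  have h1 : inner ℝ v L = 0 := by
    rw [PiLp.inner_apply, ← h v hpv]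
    exact Finset.sum_congr rfl fun i _ => by simp [hL, mul_comm]
  have h2 : inner ℝ v v = 0 := by
    conv_lhs => rw [hv]
    rw [inner_sub_left, inner_smul_left, hpv, real_inner_comm, h1]; simp
  have h3 : v = 0 := inner_self_eq_zero.1 h2
  ext i
  have h4 := congrArg (fun u : E n => u i) (sub_eq_zero.1 (hv ▸ h3))
  simpa [hL] using h4

/-- The fluxes are tangent to the boundary sphere, by the capillary condition. -/
lemma sum_mul_parallelFlux_eq_zero (hx : IsProperEmbedding x) (hν : IsUnitNormal x ν)
    (hθ : θ ∈ Set.Ioo 0 Real.pi) (hcap : HasCapillaryBoundary θ x ν) (e : E (n + 1)) (t : ℝ)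
    (hp : p ∈ Metric.sphere (0 : E n) 1) :
    ∑ i, p i * parallelFlux (Real.cos θ) e x ν t i p = 0 := by
  have hpc : p ∈ cball n := Metric.sphere_subset_closedBall hp
  have hp1 : ‖p‖ = 1 := by simpa using hp
  have hxs : ∀ q ∈ Metric.sphere (0 : E n) 1, ‖x q‖ = 1 := fun q hq => by
    simpa using hx.mapsTo_sphere hq
  have dx := hx.smooth.differentiableOn (by simp) p hpc
  have dν := hν.smooth.differentiableOn (by simp) p hpc
  have hν1 := hν.norm_eq_one p hpc
  set A := weingarten x ν p with hA
  set l : Fin n → ℝ := fun i => inner ℝ (pd i x p) (x p) with hl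
  have hNl : ∀ j, inner ℝ (pd j ν p) (x p) = (l ᵥ* A) j := by
    intro j
    rw [pd_normal_eq hx hν hpc, sum_inner, vecMul, dotProduct]
    exact Finset.sum_congr rfl fun k _ => by rw [inner_smul_left, mul_comm]; rfl
  -- |x|² is constant on the sphere, so l = ½ d|x|² annihilates the tangent vectors of the sphere.
  obtain ⟨a, ha⟩ : ∃ a : ℝ, l = a • fun i => p i := by
    refine eq_smul_of_forall_orthogonal hp1 fun v hv => ?_
    have h := fderivWithin_apply_eq_zero_of_const_on_sphere hp (dx.inner ℝ dx) (a := 1)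
      (fun q hq => by rw [real_inner_self_eq_norm_sq, hxs q hq]; norm_num) hv
    rw [fderivWithin_apply_eq_sum] at h
    simp_rw [pd_inner hpc dx dx, real_inner_comm (pd _ x p) (x p)] at h
    have h' : ∑ i, v i • (l i + l i) = 2 * ∑ i, v i * l i := by
      rw [Finset.mul_sum]
      exact Finset.sum_congr rfl fun i _ => by rw [smul_eq_mul]; ring
    have h'' : ∑ i, v i • (l i + l i) = 0 := by
      rw [← h]
    linarith
  -- The same for ⟨ν, x⟩, constant by the capillary condition, as ⟨ν, ∂ᵢx⟩ = 0. Once a ≠ 0, l is an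
  -- eigen-covector of A.
  obtain ⟨b, hb⟩ : ∃ b : ℝ, l ᵥ* A = b • fun i => p i := by
    refine eq_smul_of_forall_orthogonal hp1 fun v hv => ?_
    have h := fderivWithin_apply_eq_zero_of_const_on_sphere hp (dν.inner ℝ dx)
      (a := -Real.cos θ) (fun q hq => hcap q hq) hv
    rw [fderivWithin_apply_eq_sum] at h
    rw [← h]
    refine Finset.sum_congr rfl fun i _ => ?_
    rw [pd_inner hpc dν dx, real_inner_comm, hν.inner_pd hpc, hNl, zero_add, smul_eq_mul]
  -- If a = 0, then x is normal to Σ, so x = -cos θ ν and cos² θ = 1, contrary to sin θ > 0.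
  have ha0 : a ≠ 0 := by
    intro ha0
    have hl0 : ∀ i, inner ℝ (pd i x p) (x p) = 0 := fun i => by
      have := congrFun ha i
      simpa [ha0, hl] using this
    have h := eq_sum_tangentCoeff hν1 (hν.inner_pd hpc) (det_metric_ne_zero hx hpc) (x p)
    have h0 : tangentCoeff (fun i => pd i x p) (x p) = 0 := by
      unfold tangentCoeff
      simp only [hl0]
      exact mulVec_zero _
    rw [h0] at h
    simp only [Pi.zero_apply, zero_smul, Finset.sum_const_zero, zero_add] at h
    rw [real_inner_comm, hcap p hp] at h
    have h1 := congrArg norm h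
    rw [norm_smul, hν1, hxs p hp, mul_one, Real.norm_eq_abs, abs_neg] at h1
    have h2 : Real.cos θ ^ 2 = 1 := by rw [← sq_abs, ← h1]; norm_num
    have h3 : 0 < Real.sin θ := Real.sin_pos_of_mem_Ioo hθ
    nlinarith [Real.sin_sq_add_cos_sq θ]
  set V := minkowskiField (Real.cos θ) e x ν p with hV
  set τ := tangentCoeff (fun i => pd i x p) V with hτ
  have hVτ : V = ∑ k, τ k • pd k x p + (0 : ℝ) • ν p := by
    have h := eq_sum_tangentCoeff hν1 (hν.inner_pd hpc) (det_metric_ne_zero hx hpc) V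
    rwa [hV, inner_minkowskiField_normal _ e hν1, ← hV] at h
  -- This is ⟨V, x⟩ = 0, the point where the coefficient cos θ in V is needed.
  have hlτ : l ⬝ᵥ τ = 0 := by
    have h := inner_minkowskiField_position (Real.cos θ) e (hxs p hp) (hcap p hp)
    rw [← hV, hVτ, zero_smul, add_zero, sum_inner] at h
    rw [← h, dotProduct]
    exact Finset.sum_congr rfl fun k _ => by rw [inner_smul_left, mul_comm]; rfl
  have hpl : (fun i => p i) = a⁻¹ • l := by rw [ha, smul_smul, inv_mul_cancel₀ ha0, one_smul]
  have hlM : l ᵥ* (1 + t • A) = (1 + t * (b * a⁻¹)) • l := by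
    rw [vecMul_add, vecMul_one, vecMul_smul, hb, hpl]
    module
  have hz := dotProduct_adjugate_mulVec_eq_zero hlM hlτ
  have hY : (fun j => pd j x p + t • pd j ν p) =
      fun j => ∑ k, (1 + t • A) k j • pd k x p := by
    ext1 j
    simp only [Matrix.add_apply, Matrix.smul_apply, add_smul, Finset.sum_add_distrib,
      pd_normal_eq hx hν hpc, Finset.smul_sum, smul_smul, smul_eq_mul]
    congr 1
    simp [Matrix.one_apply]
  have hflux : ∀ i, parallelFlux (Real.cos θ) e x ν t i p =
      vol (n + 1) (Fin.cons (ν p) fun i => pd i x p) * ((1 + t • A).adjugate *ᵥ τ) i := by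
    intro i
    unfold parallelFlux flux
    rw [← hV, hY, hVτ, vol_cons_update]
  have hfin : ∑ i, p i * parallelFlux (Real.cos θ) e x ν t i p =
      vol (n + 1) (Fin.cons (ν p) fun i => pd i x p) *
        ((fun i => p i) ⬝ᵥ ((1 + t • A).adjugate *ᵥ τ)) := by
    rw [dotProduct, Finset.mul_sum]
    exact Finset.sum_congr rfl fun i _ => by rw [hflux]; ring
  rw [hfin, hpl, smul_dotProduct, hz, smul_zero, mul_zero]

/-- The coefficients are polynomials in the entries. Continuity of σₖ is deduced from this, avoiding
any continuous choice of eigenvalues. -/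
lemma continuous_charpoly_coeff (k : ℕ) :
    Continuous fun A : Matrix (Fin n) (Fin n) ℝ => A.charpoly.coeff k := by
  have h : (fun A : Matrix (Fin n) (Fin n) ℝ => A.charpoly.coeff k) =
      fun A => MvPolynomial.eval (fun ij : Fin n × Fin n => A ij.1 ij.2)
        ((charpoly.univ ℝ (Fin n)).coeff k) := by
    ext A
    exact (charpoly.univ_coeff_eval₂Hom (Fin n) (RingHom.id ℝ) (fun ij => A ij.1 ij.2) k).symm
  rw [h]
  exact (MvPolynomial.continuous_eval _).comp (continuous_pi fun ij => by fun_prop)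

lemma continuousOn_metric (hx : ContDiffOn ℝ ∞ x (cball n)) :
    ContinuousOn (metric x) (cball n) := by
  have h : ∀ i, ContinuousOn (pd i x) (cball n) := fun i =>
    continuousOn_pd (hx.of_le (by norm_cast)) i
  exact continuousOn_pi.2 fun i => continuousOn_pi.2 fun j => (h i).inner (h j)

lemma continuousOn_secondFundamentalForm (hx : ContDiffOn ℝ ∞ x (cball n))
    (hν : ContDiffOn ℝ ∞ ν (cball n)) :
    ContinuousOn (secondFundamentalForm x ν) (cball n) := by
  have h : ∀ i j, ContinuousOn (pd i (pd j x)) (cball n) := fun i j =>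
    continuousOn_pd (contDiffOn_pd hx (by norm_cast) j) i
  exact continuousOn_pi.2 fun i => continuousOn_pi.2 fun j =>
    ((h i j).inner hν.continuousOn).neg

lemma continuousOn_det_metric (hx : ContDiffOn ℝ ∞ x (cball n)) :
    ContinuousOn (fun p => (metric x p).det) (cball n) :=
  (Continuous.matrix_det continuous_id).comp_continuousOn (continuousOn_metric hx)

lemma continuousOn_weingarten (hx : IsProperEmbedding x) (hν : IsUnitNormal x ν) :
    ContinuousOn (weingarten x ν) (cball n) := by
  have h1 : ContinuousOn (fun p => ((metric x p).det)⁻¹ • (metric x p).adjugate) (cball n) :=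
    ((continuousOn_det_metric hx.smooth).inv₀ fun p hp => det_metric_ne_zero hx hp).smul
      ((Continuous.matrix_adjugate continuous_id).comp_continuousOn
        (continuousOn_metric hx.smooth))
  have h2 : weingarten x ν = fun p => (((metric x p).det)⁻¹ • (metric x p).adjugate) *
      secondFundamentalForm x ν p := by
    ext1 p
    rw [weingarten, inv_def, Ring.inverse_eq_inv']
  rw [h2]
  exact h1.mul (continuousOn_secondFundamentalForm hx.smooth hν.smooth)

lemma continuousOn_esymm_principalCurvatures (hx : IsProperEmbedding x) (hν : IsUnitNormal x ν)
    {k : ℕ} (hk : k ≤ n) :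
    ContinuousOn (fun p => (principalCurvatures x ν p).esymm k) (cball n) := by
  have h : ContinuousOn (fun p => (-1) ^ k * (weingarten x ν p).charpoly.coeff (n - k))
      (cball n) :=
    continuousOn_const.mul
      ((continuous_charpoly_coeff (n - k)).comp_continuousOn (continuousOn_weingarten hx hν))
  exact h.congr fun p hp => esymm_roots_charpoly (splits_weingarten hx hp) hk

/-- Up to a constant sign, the area density is the determinant of the tangent frame and the unit
normal. -/
lemma exists_sign_vol_eq (hx : IsProperEmbedding x) (hν : IsUnitNormal x ν) :
    ∃ s : ℝ, s ≠ 0 ∧ ∀ p ∈ cball n, vol (n + 1) (Fin.cons (ν p) fun i => pd i x p) =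
      s * Real.sqrt (metric x p).det := by
  set G : E n → ℝ := fun p => vol (n + 1) (Fin.cons (ν p) fun i => pd i x p) with hG
  have hsq : ∀ p ∈ cball n, G p ^ 2 = (metric x p).det := fun p hp =>
    vol_cons_sq (hν.norm_eq_one p hp) (hν.inner_pd hp)
  have hsqrt : ∀ p ∈ cball n, Real.sqrt (metric x p).det = |G p| := fun p hp => by
    rw [← hsq p hp, Real.sqrt_sq_eq_abs]
  have hne : ∀ p ∈ cball n, G p ≠ 0 := fun p hp =>
    vol_cons_ne_zero (hν.norm_eq_one p hp) (hν.inner_pd hp) (det_metric_ne_zero hx hp)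
  have hc : ContinuousOn G (cball n) := by
    have : G = fun p => vol (n + 1) fun a =>
        (Fin.cons ν fun i => pd i x : Fin (n + 1) → E n → E (n + 1)) a p := by
      ext p
      refine congrArg _ (funext fun a => ?_)
      exact Fin.cases rfl (fun j => rfl) a
    rw [this]
    refine (contDiffOn_vol (k := 1) fun a => ?_).continuousOn
    refine Fin.cases (hν.smooth.of_le (by norm_cast)) (fun j => ?_) a
    exact contDiffOn_pd hx.smooth (by norm_cast) j
  -- The image of the connected ball is an interval that misses 0, so G has constant sign.
  have hconn : (G '' cball n).OrdConnected :=
    ((convex_closedBall (0 : E n) 1).isPreconnected.image G hc).ordConnected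
  have hnot : ∀ p ∈ cball n, ∀ q ∈ cball n, G p < 0 → 0 < G q → False := by
    intro p hp q hq h1 h2
    obtain ⟨r, hr, hr0⟩ := hconn.out (Set.mem_image_of_mem G hp) (Set.mem_image_of_mem G hq)
      ⟨h1.le, h2.le⟩
    exact hne r hr hr0
  rcases lt_or_gt_of_ne (hne 0 (by simp)) with h0 | h0
  · refine ⟨-1, by norm_num, fun p hp => ?_⟩
    have : G p ≤ 0 := not_lt.1 fun h => hnot 0 (by simp) p hp h0 h
    rw [hsqrt p hp, abs_of_nonpos this]; ring
  · refine ⟨1, by norm_num, fun p hp => ?_⟩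
    have : 0 ≤ G p := not_lt.1 fun h => hnot p hp 0 (by simp) h h0
    rw [hsqrt p hp, abs_of_nonneg this]; ring

/-- A polynomial identity between integrals holds coefficientwise. -/
lemma setIntegral_eq_zero_of_sum_pow {s : Set (E n)} {m : ℕ} {F : ℕ → E n → ℝ}
    (hF : ∀ k < m, IntegrableOn (F k) s)
    (h : ∀ t : ℝ, ∫ p in s, ∑ k ∈ Finset.range m, t ^ k * F k p = 0) {k : ℕ} (hk : k < m) :
    ∫ p in s, F k p = 0 := by
  set P : Polynomial ℝ := ∑ k ∈ Finset.range m, Polynomial.monomial k (∫ p in s, F k p) with hP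
  have hP0 : P = 0 := by
    refine Polynomial.funext fun t => ?_
    rw [hP, Polynomial.eval_finsetSum, Polynomial.eval_zero, ← h t, integral_finsetSum]
    · refine Finset.sum_congr rfl fun k _ => ?_
      rw [Polynomial.eval_monomial, integral_const_mul, mul_comm]
    · exact fun k hk => (hF k (Finset.mem_range.1 hk)).const_mul _
  have := congrArg (Polynomial.coeff · k) hP0
  simpa [hP, Polynomial.finsetSum_coeff, Polynomial.coeff_monomial, hk] using this

/-- The Minkowski formula of order `k + 1`. -/
theorem minkowski_formula (hn : 0 < n) (hθ : θ ∈ Set.Ioo 0 Real.pi) (hx : IsProperEmbedding x)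
    (hν : IsUnitNormal x ν) (hcap : HasCapillaryBoundary θ x ν) (e : E (n + 1)) {k : ℕ}
    (hk : k < n) :
    surfaceIntegral x (fun p => H x ν k p *
        (inner ℝ (x p) e + Real.cos θ * inner ℝ (ν p) e)) =
      surfaceIntegral x (fun p => H x ν (k + 1) p * inner ℝ (confField e (x p)) (ν p)) := by
  set q : E n → ℝ := fun p => inner ℝ (x p) e + Real.cos θ * inner ℝ (ν p) e with hq
  set r : E n → ℝ := fun p => inner ℝ (confField e (x p)) (ν p) with hr
  set σ : ℕ → E n → ℝ := fun k p => (principalCurvatures x ν p).esymm k with hσ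
  set w : E n → ℝ := fun p => Real.sqrt (metric x p).det with hw
  -- The coefficient of tᵏ in the divergence, up to the constant sign of the frame determinant.
  set F : ℕ → E n → ℝ := fun k p =>
    (q p * ((n - k : ℝ) * σ k p) - r p * ((k + 1 : ℝ) * σ (k + 1) p)) * w p with hF
  have cx := hx.smooth.continuousOn
  have cν := hν.smooth.continuousOn
  have cq : ContinuousOn q (cball n) := by fun_prop
  have cr : ContinuousOn r (cball n) :=
    ((contDiff_confField e).continuous.comp_continuousOn cx).inner cν
  have cw : ContinuousOn w (cball n) :=
    Real.continuous_sqrt.comp_continuousOn (continuousOn_det_metric hx.smooth)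
  have cσ : ∀ k ≤ n, ContinuousOn (σ k) (cball n) := fun k hk =>
    continuousOn_esymm_principalCurvatures hx hν hk
  have iF : ∀ k < n, IntegrableOn (F k) (cball n) := by
    intro k hk
    have c1 := cσ k hk.le
    have c2 := cσ (k + 1) hk
    have c : ContinuousOn (F k) (cball n) := by fun_prop
    exact c.integrableOn_compact isCompact_cball
  have hzero : ∀ t : ℝ, ∫ p in cball n, ∑ k ∈ Finset.range n, t ^ k * F k p = 0 := by
    intro t
    obtain ⟨s, hs, hG⟩ := exists_sign_vol_eq hx hν
    have hdiv := integral_divergence_eq_zero hn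
      (fun i => contDiffOn_parallelFlux (Real.cos θ) e hx.smooth hν.smooth t i)
      (fun p hp => sum_mul_parallelFlux_eq_zero hx hν hθ hcap e t hp)
    have e1 : ∫ p in cball n, ∑ i, pd i (parallelFlux (Real.cos θ) e x ν t i) p =
        ∫ p in cball n, s * ∑ k ∈ Finset.range n, t ^ k * F k p := by
      refine setIntegral_congr_fun measurableSet_closedBall fun p hp => ?_
      rw [sum_pd_parallelFlux hx hν hp, hG p hp, mul_assoc, Finset.mul_sum]
      congr 1
      exact Finset.sum_congr rfl fun k _ => by simp only [hF, hw, hσ, hq, hr]; ring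
    rw [e1, integral_const_mul] at hdiv
    exact (mul_eq_zero.1 hdiv).resolve_left hs
  have hFk := setIntegral_eq_zero_of_sum_pow iF hzero hk
  -- Since (k + 1) C(n, k + 1) = (n - k) C(n, k), the normalizations of Hₖ and Hₖ₊₁ leave one common
  -- factor K.
  set K : ℝ := (k + 1) * (n.choose (k + 1) : ℝ) with hK
  have hK0 : K ≠ 0 := by
    have := Nat.choose_pos (n := n) (k := k + 1) hk
    positivity
  have hKk : K = (n - k) * (n.choose k : ℝ) := by
    have := Nat.choose_succ_right_eq n k
    have h' : ((n.choose (k + 1) * (k + 1) : ℕ) : ℝ) = ((n.choose k * (n - k) : ℕ) : ℝ) := by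
      rw [this]
    rw [Nat.cast_mul, Nat.cast_mul, Nat.cast_sub hk.le] at h'
    push_cast at h'
    rw [hK]; linarith
  have hc0 : (n.choose k : ℝ) ≠ 0 := by
    have := Nat.choose_pos (n := n) (k := k) hk.le
    positivity
  have hc1 : (n.choose (k + 1) : ℝ) ≠ 0 := by
    have := Nat.choose_pos (n := n) (k := k + 1) hk
    positivity
  have cH : ∀ k ≤ n, ContinuousOn (H x ν k) (cball n) := fun k hk => (cσ k hk).div_const _
  have i1 : IntegrableOn (fun p => H x ν k p * q p * w p) (cball n) :=
    (((cH k hk.le).mul cq).mul cw).integrableOn_compact isCompact_cball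
  have i2 : IntegrableOn (fun p => H x ν (k + 1) p * r p * w p) (cball n) :=
    (((cH (k + 1) hk).mul cr).mul cw).integrableOn_compact isCompact_cball
  have e2 : F k = fun p => K * (H x ν k p * q p * w p - H x ν (k + 1) p * r p * w p) := by
    ext1 p
    have h1 : (n - k : ℝ) * σ k p = K * H x ν k p := by
      rw [hKk, H]; field_simp; rfl
    have h2 : (k + 1 : ℝ) * σ (k + 1) p = K * H x ν (k + 1) p := by
      rw [hK, H]; field_simp; rfl
    simp only [hF]
    rw [h1, h2]; ring
  rw [e2, integral_const_mul, integral_sub i1 i2] at hFk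
  exact sub_eq_zero.1 ((mul_eq_zero.1 hFk).resolve_left hK0)

lemma inner_fderiv_confField_add {m : ℕ} (e y v w : E m) :
    inner ℝ (fderiv ℝ (confField e) y v) w + inner ℝ v (fderiv ℝ (confField e) y w) =
      2 * inner ℝ y e * inner ℝ v w := by
  rw [fderiv_confField, fderiv_confField]
  simp only [inner_add_left, inner_sub_left, inner_add_right, inner_sub_right, inner_smul_left,
    inner_smul_right, real_inner_comm e w, real_inner_comm v y]
  rw [real_inner_comm w e]
  simp
  ring

lemma inner_confField_self {m : ℕ} (e : E m) {y : E m} (hy : ‖y‖ = 1) :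
    inner ℝ (confField e y) y = 0 := by
  unfold confField
  rw [inner_sub_left, inner_smul_left, inner_smul_left, real_inner_self_eq_norm_sq, hy,
    real_inner_comm y e]
  simp

end

end Capillary

end

theorem mainTheorem4 (n : ℕ) (hn : 2 ≤ n) (θ : ℝ) (hθ : θ ∈ Set.Ioo 0 Real.pi)
    (x ν : Capillary.E n → Capillary.E (n + 1))
    (hx : Capillary.IsProperEmbedding x) (hν : Capillary.IsUnitNormal x ν)
    (hcap : Capillary.HasCapillaryBoundary θ x ν)
    (e : Capillary.E (n + 1)) (he : ‖e‖ = 1) :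
    (∀ k : ℕ, 1 ≤ k → k ≤ n →
      Capillary.surfaceIntegral x (fun p => Capillary.H x ν (k - 1) p *
          (inner ℝ (x p) e + Real.cos θ * inner ℝ (ν p) e)) =
        Capillary.surfaceIntegral x (fun p => Capillary.H x ν k p *
          inner ℝ (Capillary.confField e (x p)) (ν p))) ∧
    (∀ y v w : Capillary.E (n + 1),
      inner ℝ (fderiv ℝ (Capillary.confField e) y v) w +
        inner ℝ v (fderiv ℝ (Capillary.confField e) y w) = 2 * inner ℝ y e * inner ℝ v w) ∧
    (∀ y : Capillary.E (n + 1), ‖y‖ = 1 → inner ℝ (Capillary.confField e y) y = 0) := by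
  refine ⟨fun k hk hkn => ?_, Capillary.inner_fderiv_confField_add e,
    fun y hy => Capillary.inner_confField_self e hy⟩
  obtain ⟨m, rfl⟩ := Nat.exists_eq_add_of_le' hk
  exact Capillary.minkowski_formula (by omega) hθ hx hν hcap e (by omega)
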